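/- **Setting.** An online packing instance consists of a budget $B>0$ and $T$ requests $X_1,\dots,X_T$; each request is a set of options $(r,v)\in[0,1]\times[0,1]^d$ that contains $(0,\mathbf 0)$. Let $$T\cdot\mathrm{OPT}=\sup\Big\{\sum_{i=1}^T r_i:\ (r_i,v_i)\in X_i,\ \sum_{i=1}^T v_i\le B\mathbf 1\Big\}.$$ The requests arrive in uniformly random order, $A_t=X_{\pi(t)}$; upon the arrival of $A_t$ an option of $A_t$ has to be played irrevocably, and $\sum_t v_t\le B\mathbf 1$ must never be violated. The competitive ratio of an algorithm is its expected total reward divided by $T\cdot\mathrm{OPT}$. Maxima of $r-p\cdot v$ over a request, $p\ge 0$, are assumed to exist; ties are broken by an arbitrary fixed rule. Put $L=\log\max\{d,2\}$ (so $L=\log d$ for $d\ge 2$). **Algorithm with parameters $\epsilon,Z$.** Start with $w_{0,j}=1$, $\theta_{1,j}=\frac1{d+1}$. At step $t$ choose $(r_t,v_t)\in\arg\max_{(r,v)\in A_t}\{r-Z\,\theta_t\cdot v\}$. If $\sum_{t'\le t}v_{t',j}\ge B$ for some $j$, exit: the option just chosen is discarded and $(0,\mathbf 0)$ is played from then on.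 Otherwise play $(r_t,v_t)$ and update $$w_{t,j}=w_{t-1,j}(1+\epsilon)^{v_{t,j}-B/T},\qquad \theta_{t+1,j}=\frac{w_{t,j}}{1+\sum_{j'}w_{t,j'}}.$$ **Estimate of $Z$.** Let $\eta=\sqrt{3\log((d+2)/\epsilon^2)}$ and $n=\lceil (4\eta^2\epsilon^2/L)\,T\rceil$. From the first $n$ requests, with $\delta=n/T$, compute $\hat Z=\frac{2}{\delta B}V$, where $V$ is the value of the packing LP (fractional choice of options, of total weight at most $1$ per request) of these $n$ requests with budget $\delta B+\eta\sqrt{\delta B}$ in every coordinate. **Complete algorithm.** Play $(0,\mathbf 0)$ on the first $n$ requests, compute $\hat Z$, and run the algorithm above with $Z=\hat Z$ (and the same $B$, $T$, $\epsilon$) on the remaining requests. **Theorem.** Consider all $d$, $T$, all instances and all $\epsilon>0$ with $\min\{B,\ T\cdot\mathrm{OPT}\}\ge L/\epsilon^2$. 1. For every constant $K$ there is a constant $C$, depending only on $K$, such that whenever $\frac{T\cdot\mathrm{OPT}}{B}\le Z\le K\frac{T\cdot\mathrm{OPT}}{B}$, the algorithm with parameters $\epsilon,Z$ plays only available options, never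 violates a budget, and has competitive ratio at least $1-C\epsilon$ in the random permutation model. 2. There are universal constants $C$ and $\epsilon_0\in(0,1)$ such that for $\epsilon\le\epsilon_0$ the sample satisfies $n<T$ and $n\le C\epsilon^2\log(1/\epsilon)\,T$, and with probability at least $1-\epsilon^2$ $$\frac{T\cdot\mathrm{OPT}}{B}\le\hat Z\le\frac92\cdot\frac{T\cdot\mathrm{OPT}}{B}.$$ 3. There is a universal constant $C$ such that the complete algorithm plays only available options, never violates a budget, and has competitive ratio at least $1-C\epsilon$ in the random permutation model. 4. Without any condition on the input, each step of either algorithm uses at most one maximization of a linear function over the current request and $O(d+1)$ scalar operations (arithmetic, powers, logarithms, square roots, comparisons), besides solving linear programs. The algorithm with given $Z$ solves no LP, and the complete algorithm solves at most one LP in total. -/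

import Mathlib

open scoped BigOperators

noncomputable section

namespace OnlinePacking

/-! ### Instances, benchmark, random order -/

/-- An option `(r, v)`: a reward together with a `d`-dimensional cost vector. -/
abbrev Choice (d : ℕ) := ℝ × (Fin d → ℝ)

/-- An online packing instance: a budget `B > 0` and `T` requests, each a set of options with
rewards and costs in `[0,1]` that contains the origin ("do nothing"). -/
structure Instance (d T : ℕ) where
  B : ℝ
  B_pos : 0 < B
  X : Fin T → Set (Choice d)
  reward_mem : ∀ i, ∀ a ∈ X i, a.1 ∈ Set.Icc (0 : ℝ) 1
  cost_mem : ∀ i, ∀ a ∈ X i, ∀ j, a.2 j ∈ Set.Icc (0 : ℝ) 1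
  zero_mem : ∀ i, (0 : Choice d) ∈ X i

/-- The offline benchmark: the best average reward of a choice of one option per request
whose total cost is at most `B` in every coordinate. -/
def Instance.OPT {d T : ℕ} (P : Instance d T) : ℝ :=
  sSup {x | ∃ c : Fin T → Choice d, (∀ i, c i ∈ P.X i) ∧ (∀ j, ∑ i, (c i).2 j ≤ P.B) ∧
    x = (∑ i, (c i).1) / T}

/-- The arrival sequence `A_t = X_{π(t)}`, `t < T` (extended by trivial requests, which are
never looked at). -/
def Instance.arrival {d T : ℕ} (P : Instance d T) (π : Equiv.Perm (Fin T)) (t : ℕ) :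
    Set (Choice d) :=
  if h : t < T then P.X (π ⟨t, h⟩) else {0}

/-- Expectation over a uniformly random permutation. -/
def permMean {T : ℕ} (f : Equiv.Perm (Fin T) → ℝ) : ℝ :=
  (∑ π, f π) / (Fintype.card (Equiv.Perm (Fin T)) : ℝ)

/-- Probability over a uniformly random permutation. -/
def permProb {T : ℕ} (p : Equiv.Perm (Fin T) → Prop) : ℝ :=
  (Nat.card {π : Equiv.Perm (Fin T) // p π} : ℝ) / (Fintype.card (Equiv.Perm (Fin T)) : ℝ)

/-- A rule that solves `argmax_{(r,v) ∈ A} r - p · v` for every request of the instance and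
every price vector `p ≥ 0`; how it breaks ties is arbitrary. -/
def IsArgmaxRule {d T : ℕ} (P : Instance d T) (pick : Set (Choice d) → (Fin d → ℝ) → Choice d) :
    Prop :=
  ∀ i, ∀ p : Fin d → ℝ, (∀ j, 0 ≤ p j) → pick (P.X i) p ∈ P.X i ∧
    ∀ a ∈ P.X i, a.1 - ∑ j, p j * a.2 j ≤ (pick (P.X i) p).1 - ∑ j, p j * (pick (P.X i) p).2 j

/-! ### Computations with operation counts

A computation returns a value and counts scalar operations (arithmetic, powers, logarithms,
square roots, comparisons), maximizations of a linear function over one request, and solved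
linear programs. -/

structure Counted (α : Type) where
  val : α
  arith : ℕ
  linMax : ℕ
  lp : ℕ

instance : Monad Counted where
  pure a := ⟨a, 0, 0, 0⟩
  bind x f :=
    ⟨(f x.val).val, x.arith + (f x.val).arith, x.linMax + (f x.val).linMax, x.lp + (f x.val).lp⟩

namespace Counted

/-- One scalar operation. -/
def op (x : ℝ) : Counted ℝ := ⟨x, 1, 0, 0⟩

/-- Perform a computation for every coordinate, one after the other. -/
def vec {d : ℕ} (f : Fin d → Counted ℝ) : Counted (Fin d → ℝ) :=
  ⟨fun j => (f j).val, ∑ j, (f j).arith, ∑ j, (f j).linMax, ∑ j, (f j).lp⟩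

/-- Sum of `d` numbers, `d` scalar operations. -/
def sum {d : ℕ} (x : Fin d → ℝ) : Counted ℝ := ⟨∑ j, x j, d, 0, 0⟩

open Classical in
/-- Does some coordinate reach the bound?  `d` comparisons. -/
def anyGe {d : ℕ} (x : Fin d → ℝ) (b : ℝ) : Counted Bool := ⟨decide (∃ j, b ≤ x j), d, 0, 0⟩

/-- One maximization of `r - p · v` over a request. -/
def maximize {d : ℕ} (pick : Set (Choice d) → (Fin d → ℝ) → Choice d)
    (A : Set (Choice d)) (p : Fin d → ℝ) : Counted (Choice d) :=
  ⟨pick A p, 0, 1, 0⟩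

end Counted

/-- The value of the packing LP with requests `Y` and budget `b` in every coordinate: the
variable `x i a` is the fraction of option `a` used for request `i`. -/
def lpValue {d n : ℕ} (Y : Fin n → Set (Choice d)) (b : ℝ) : ℝ :=
  sSup {z | ∃ x : Fin n → (Choice d →₀ ℝ),
    (∀ i a, 0 ≤ x i a) ∧ (∀ i, ∀ a ∈ (x i).support, a ∈ Y i) ∧
    (∀ i, ((x i).sum fun _ y => y) ≤ 1) ∧
    (∀ j, ∑ i, ((x i).sum fun a y => y * a.2 j) ≤ b) ∧
    z = ∑ i, (x i).sum fun a y => y * a.1}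

/-- Solving one LP. -/
def Counted.solveLP {d n : ℕ} (Y : Fin n → Set (Choice d)) (b : ℝ) : Counted ℝ :=
  ⟨lpValue Y b, 0, 0, 1⟩

/-! ### Online algorithms -/

/-- An online algorithm with memory `σ`: upon each request it updates its memory and plays. -/
structure Alg (d : ℕ) (σ : Type) where
  init : σ
  step : σ → Set (Choice d) → Counted (σ × Choice d)

namespace Alg

variable {d T : ℕ} {σ : Type}

/-- Memory after the first `t` requests. -/
def state (alg : Alg d σ) (A : ℕ → Set (Choice d)) : ℕ → σ
  | 0 => alg.init
  | t + 1 => (alg.step (alg.state A t) (A t)).val.1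

/-- The computation made upon request number `t` (counted from `0`). -/
def round (alg : Alg d σ) (A : ℕ → Set (Choice d)) (t : ℕ) : Counted (σ × Choice d) :=
  alg.step (alg.state A t) (A t)

/-- The option played for request number `t`. -/
def played (alg : Alg d σ) (A : ℕ → Set (Choice d)) (t : ℕ) : Choice d :=
  (alg.round A t).val.2

/-- For every arrival order only available options are played and no budget is violated. -/
def Feasible (alg : Alg d σ) (P : Instance d T) : Prop :=
  ∀ π : Equiv.Perm (Fin T),
    (∀ t < T, alg.played (P.arrival π) t ∈ P.arrival π t) ∧
    ∀ j, ∑ t ∈ Finset.range T, (alg.played (P.arrival π) t).2 j ≤ P.B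

/-- Expected total reward in the random permutation model, divided by `T · OPT`. -/
def competitiveRatio (alg : Alg d σ) (P : Instance d T) : ℝ :=
  permMean (fun π : Equiv.Perm (Fin T) =>
    ∑ t ∈ Finset.range T, (alg.played (P.arrival π) t).1) / (T * P.OPT)

end Alg

/-! ### The packing algorithm with a given parameter `Z` -/

/-- Memory: weights `w`, dual vector `θ`, accumulated cost `load`, and whether it has exited. -/
structure Memory (d : ℕ) where
  w : Fin d → ℝ
  θ : Fin d → ℝ
  load : Fin d → ℝ
  exited : Bool

def initMemory (d : ℕ) : Memory d := ⟨fun _ => 1, fun _ => 1 / (d + 1), fun _ => 0, false⟩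

open Counted in
/-- One step.  Choose `(r, v) ∈ argmax r - Z θ · v`.  If the accumulated cost, including `v`,
reaches `B` in some coordinate, exit (the chosen option is discarded, and only the origin is
played from here on).  Otherwise play `(r, v)` and make the multiplicative weight update. -/
def packingStep {d : ℕ} (pick : Set (Choice d) → (Fin d → ℝ) → Choice d) (B : ℝ) (T : ℕ)
    (ε Z : ℝ) (s : Memory d) (A : Set (Choice d)) : Counted (Memory d × Choice d) :=
  if s.exited then pure (s, 0) else do
    let price ← vec fun j => op (Z * s.θ j)
    let a ← maximize pick A price
    let load ← vec fun j => op (s.load j + a.2 j)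
    let full ← anyGe load B
    if full then pure ({ s with exited := true }, 0) else do
      let rate ← op (B / T)
      let base ← op (1 + ε)
      let w ← vec fun j => do
        let g ← op (a.2 j - rate)
        let f ← op (base ^ g)
        op (s.w j * f)
      let W ← sum w
      let W1 ← op (1 + W)
      let θ ← vec fun j => op (w j / W1)
      pure (⟨w, θ, load, false⟩, a)

/-- The online packing algorithm, with parameter `Z` given. -/
def packingAlg {d : ℕ} (pick : Set (Choice d) → (Fin d → ℝ) → Choice d) (B : ℝ) (T : ℕ)
    (ε Z : ℝ) : Alg d (Memory d) :=
  ⟨initMemory d, packingStep pick B T ε Z⟩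

/-! ### Estimating `Z` from a sample -/

/-- `η = √(3 log((d+2)/ρ))` for the failure probability `ρ = ε²`. -/
def eta (d : ℕ) (ε : ℝ) : ℝ := Real.sqrt (3 * Real.log ((d + 2) / ε ^ 2))

/-- Number of sampled requests: the fraction `4 η² ε² / log d` of `T`, rounded up
(with `log 2` in place of `log d` if `d < 2`). -/
def sampleSize (d T : ℕ) (ε : ℝ) : ℕ :=
  ⌈4 * eta d ε ^ 2 * ε ^ 2 / Real.log (max d 2 : ℕ) * T⌉₊

open Counted in
/-- With `n` sampled requests and `δ = n / T`, solve the LP of the sample with budget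
`δ B + η √(δ B)`, divide its value by `δ` to estimate `T · OPT`, and return twice the
estimate divided by `B`. -/
def estimateZ {d n : ℕ} (B : ℝ) (T : ℕ) (ε : ℝ) (Y : Fin n → Set (Choice d)) : Counted ℝ := do
  let δ ← op (n / T)
  let e2 ← op (ε ^ 2)
  let d2 ← op (d + 2)
  let q ← op (d2 / e2)
  let l ← op (Real.log q)
  let l3 ← op (3 * l)
  let η ← op (Real.sqrt l3)
  let δB ← op (δ * B)
  let root ← op (Real.sqrt δB)
  let slack ← op (η * root)
  let b ← op (δB + slack)
  let v ← solveLP Y b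
  let est ← op (v / δ)
  let twice ← op (2 * est)
  op (twice / B)

/-- The value of `Z` computed from the first `sampleSize d T ε` requests. -/
def estimatedZ {d T : ℕ} (P : Instance d T) (ε : ℝ) (π : Equiv.Perm (Fin T)) : ℝ :=
  (estimateZ P.B T ε fun i : Fin (sampleSize d T ε) => P.arrival π i).val

/-! ### The complete algorithm -/

/-- Memory of the complete algorithm: the sample seen so far, or the estimate `Z` and the
memory of the packing algorithm. -/
inductive FullMemory (d : ℕ) where
  | sampling (seen : List (Set (Choice d)))
  | running (Z : ℝ) (s : Memory d)

/-- One step of the complete algorithm: during the first `sampleSize d T ε` requests play the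
origin, estimate `Z` at the end of the sample, and run the packing algorithm afterwards. -/
def fullStep {d : ℕ} (pick : Set (Choice d) → (Fin d → ℝ) → Choice d) (B : ℝ) (T : ℕ) (ε : ℝ) :
    FullMemory d → Set (Choice d) → Counted (FullMemory d × Choice d)
  | .sampling seen, A =>
      if (seen ++ [A]).length < sampleSize d T ε then pure (.sampling (seen ++ [A]), 0) else do
        let Z ← estimateZ B T ε (seen ++ [A]).get
        pure (.running Z (initMemory d), 0)
  | .running Z s, A => do
      let r ← packingStep pick B T ε Z s A
      pure (.running Z r.1, r.2)

/-- The online packing algorithm that estimates `Z` itself. -/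
def fullAlg {d : ℕ} (pick : Set (Choice d) → (Fin d → ℝ) → Choice d) (B : ℝ) (T : ℕ)
    (ε : ℝ) : Alg d (FullMemory d) :=
  ⟨.sampling [], fullStep pick B T ε⟩

end OnlinePacking

end

open scoped BigOperators

noncomputable section

namespace OnlinePacking

/-! ### Averages over permutations -/

section PermMean

variable {T : ℕ}

/-! The prices come from a dual player who runs multiplicative weights on the budgets. Write M for
T·OPT and b for B/T, and fix one near-optimal offline choice with total reward R; let (r*, v*)
denote its option for the arriving request. Maximality of the chosen option gives r - Zθ·v ≥ r* -
Zθ·v* in every step before the exit. Summed, with costs measured relative to b, this bounds the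
reward below by Σ (R/T + Zθ·(v - b)) minus the two error sums Σ (R/T - r*) and Σ Zθ·(v* - b).

The main sum is bounded deterministically. By the regret bound `packing_regret`, Σ θ·(v - b) is
almost as large as 0 and as the excess load of any coordinate. If the run exits at time t, some load
is at least B - 1, so the main sum contains about Z(B - tb) ≥ R(1 - t/T), which pays for the lost
steps (`packing_value`). This is where ZB ≥ M enters.

The error sums are small on average (`permMean_sum_mul_sub_le`). Prices and exit status depend on
the past only, and given the past the next request is uniform among the remaining ones, so its value
may be replaced by the average over all of these. That average comes from a sample without
replacement, whose exponential moments are at most those of independent sampling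
(`permMean_prod_le`). A soft maximum over coordinates bounds the error by O((log d + ε²B)/(ε√(Ts)))
per unit of price when s requests remain, and Σ 1/√s ≤ 2√T. The total loss is O(KεM); see
`permMean_packing_ge`.

For the estimate of Z, concentration is needed only for one fixed primal and one fixed dual solution
of the whole instance. The primal one, restricted to the sample, bounds the sample LP below; the
dual one bounds it above by weak duality (`permProb_estimatedZ`). A dual solution of value at most
9/8·M exists because independent rounding shows that mixtures of choices hardly beat single choices
(`reward_le_of_mem_convexHull`), and separation of convex sets then yields prices. Since the
estimate depends on the sample only, the analysis of the algorithm applies from the end of the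
sample on, and the sample itself costs a fraction O(ε) of M. -/

lemma card_perm_pos : (0 : ℝ) < Fintype.card (Equiv.Perm (Fin T)) := by
  exact_mod_cast Fintype.card_pos

lemma permMean_mono {f g : Equiv.Perm (Fin T) → ℝ} (h : ∀ π, f π ≤ g π) :
    permMean f ≤ permMean g :=
  div_le_div_of_nonneg_right (Finset.sum_le_sum fun π _ => h π) card_perm_pos.le

lemma permMean_nonneg {f : Equiv.Perm (Fin T) → ℝ} (h : ∀ π, 0 ≤ f π) : 0 ≤ permMean f :=
  div_nonneg (Finset.sum_nonneg fun π _ => h π) card_perm_pos.le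

lemma permMean_add (f g : Equiv.Perm (Fin T) → ℝ) :
    permMean (fun π => f π + g π) = permMean f + permMean g := by
  simp only [permMean, Finset.sum_add_distrib, add_div]

lemma permMean_sub (f g : Equiv.Perm (Fin T) → ℝ) :
    permMean (fun π => f π - g π) = permMean f - permMean g := by
  simp only [permMean, Finset.sum_sub_distrib, sub_div]

lemma permMean_const_mul (a : ℝ) (f : Equiv.Perm (Fin T) → ℝ) :
    permMean (fun π => a * f π) = a * permMean f := by
  simp only [permMean, ← Finset.mul_sum, mul_div_assoc]

lemma permMean_const (a : ℝ) : permMean (fun _ : Equiv.Perm (Fin T) => a) = a := by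
  have := (card_perm_pos (T := T)).ne'
  rw [permMean, Finset.sum_const, Finset.card_univ, nsmul_eq_mul]
  field_simp

lemma permMean_sum {ι : Type*} (s : Finset ι) (f : ι → Equiv.Perm (Fin T) → ℝ) :
    permMean (fun π => ∑ i ∈ s, f i π) = ∑ i ∈ s, permMean (f i) := by
  simp only [permMean]
  rw [Finset.sum_comm, Finset.sum_div]

lemma permMean_comp_mul (σ : Equiv.Perm (Fin T)) (f : Equiv.Perm (Fin T) → ℝ) :
    permMean (fun π => f (π * σ)) = permMean f := by
  simp only [permMean]
  congr 1
  exact Equiv.sum_comp (Equiv.mulRight σ) f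

open Classical in
lemma permProb_eq_permMean (p : Equiv.Perm (Fin T) → Prop) :
    permProb p = permMean (fun π => if p π then 1 else 0) := by
  simp only [permProb, permMean, Finset.sum_boole, Nat.card_eq_fintype_card, Fintype.card_subtype]

lemma permProb_mono {p q : Equiv.Perm (Fin T) → Prop} (h : ∀ π, p π → q π) :
    permProb p ≤ permProb q := by
  classical
  rw [permProb_eq_permMean, permProb_eq_permMean]
  refine permMean_mono fun π => ?_
  have := h π
  split_ifs <;> simp_all

lemma permProb_nonneg (p : Equiv.Perm (Fin T) → Prop) : 0 ≤ permProb p :=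
  div_nonneg (Nat.cast_nonneg _) card_perm_pos.le

lemma permProb_compl (p : Equiv.Perm (Fin T) → Prop) :
    permProb (fun π => ¬ p π) = 1 - permProb p := by
  classical
  have h := permMean_sub (fun _ => 1) fun π => if p π then (1 : ℝ) else 0
  rw [permMean_const] at h
  rw [permProb_eq_permMean, permProb_eq_permMean, ← h]
  congr 1
  ext π
  by_cases hp : p π <;> simp [hp]

lemma permProb_le_one (p : Equiv.Perm (Fin T) → Prop) : permProb p ≤ 1 := by
  have h := permProb_compl p
  linarith [permProb_nonneg fun π => ¬ p π]

lemma permProb_or_le (p q : Equiv.Perm (Fin T) → Prop) :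
    permProb (fun π => p π ∨ q π) ≤ permProb p + permProb q := by
  classical
  simp only [permProb_eq_permMean]
  rw [← permMean_add]
  refine permMean_mono fun π => ?_
  by_cases hp : p π <;> by_cases hq : q π <;> simp [hp, hq]

lemma permProb_exists_le {d : ℕ} (p : Fin d → Equiv.Perm (Fin T) → Prop) :
    permProb (fun π => ∃ j, p j π) ≤ ∑ j, permProb (p j) := by
  classical
  simp only [permProb_eq_permMean]
  rw [← permMean_sum]
  refine permMean_mono fun π => ?_
  have hnn : ∀ j ∈ Finset.univ, (0 : ℝ) ≤ if p j π then 1 else 0 := fun j _ => by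
    split_ifs <;> norm_num
  split_ifs with h
  · obtain ⟨j, hj⟩ := h
    calc (1 : ℝ) = if p j π then 1 else 0 := by simp [hj]
      _ ≤ _ := Finset.single_le_sum hnn (Finset.mem_univ j)
  · exact Finset.sum_nonneg hnn

/-- Markov's inequality in exponential form. -/
lemma permProb_pos_le_exp (f : Equiv.Perm (Fin T) → ℝ) :
    permProb (fun π => 0 < f π) ≤ permMean (fun π => Real.exp (f π)) := by
  classical
  rw [permProb_eq_permMean]
  refine permMean_mono fun π => ?_
  split_ifs with h
  · exact Real.one_le_exp h.le
  · exact (Real.exp_pos _).le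

/-! ### Sampling without replacement -/

/-- Replace y (π a) by the average of y (π l) over all l. For l outside S, the transposition of a
and l gives equality. For l in S, the product y (π a) * y (π l) is at most the mean of the two
squares, and the same transposition shows that both squares contribute equally. -/
lemma permMean_mul_prod_le {y : Fin T → ℝ} (hy : ∀ i, 0 ≤ y i) {a : Fin T} {S : Finset (Fin T)}
    (ha : a ∉ S) :
    permMean (fun π => y (π a) * ∏ k ∈ S, y (π k)) ≤
      (∑ i, y i) / T * permMean (fun π => ∏ k ∈ S, y (π k)) := by
  have hT : (0 : ℝ) < T := by exact_mod_cast a.pos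
  rw [div_mul_eq_mul_div, le_div_iff₀ hT, ← permMean_const_mul]
  have hsum : ∀ π : Equiv.Perm (Fin T),
      (∑ i, y i) * ∏ k ∈ S, y (π k) = ∑ l, y (π l) * ∏ k ∈ S, y (π k) := by
    intro π
    rw [← Finset.sum_mul, Equiv.sum_comp π y]
  simp only [hsum]
  rw [permMean_sum]
  have hcard : (∑ _l : Fin T, permMean (fun π => y (π a) * ∏ k ∈ S, y (π k))) =
      permMean (fun π => y (π a) * ∏ k ∈ S, y (π k)) * T := by
    simp [mul_comm]
  rw [← hcard]
  refine Finset.sum_le_sum fun l _ => ?_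
  by_cases hl : l ∈ S
  · have hS : ∀ π : Equiv.Perm (Fin T), ∏ k ∈ S, y (π k) = y (π l) * ∏ k ∈ S.erase l, y (π k) :=
      fun π => (Finset.mul_prod_erase S (fun k => y (π k)) hl).symm
    simp only [hS]
    have hswap : permMean (fun π => y (π a) ^ 2 * ∏ k ∈ S.erase l, y (π k)) =
        permMean (fun π => y (π l) ^ 2 * ∏ k ∈ S.erase l, y (π k)) := by
      rw [← permMean_comp_mul (Equiv.swap a l)]
      congr 1
      ext π
      congr 1
      · simp
      · refine Finset.prod_congr rfl fun k hk => ?_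
        have h1 : k ≠ l := Finset.ne_of_mem_erase hk
        have h2 : k ≠ a := fun h => ha (h ▸ Finset.mem_of_mem_erase hk)
        simp [Equiv.swap_apply_of_ne_of_ne h2 h1]
    have hle : permMean (fun π => y (π a) * (y (π l) * ∏ k ∈ S.erase l, y (π k))) ≤
        permMean (fun π => 1 / 2 * (y (π a) ^ 2 * ∏ k ∈ S.erase l, y (π k)) +
          1 / 2 * (y (π l) ^ 2 * ∏ k ∈ S.erase l, y (π k))) := by
      refine permMean_mono fun π => ?_
      have hp : 0 ≤ ∏ k ∈ S.erase l, y (π k) := Finset.prod_nonneg fun k _ => hy _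
      nlinarith [mul_nonneg hp (sq_nonneg (y (π a) - y (π l)))]
    rw [permMean_add, permMean_const_mul, permMean_const_mul, hswap] at hle
    refine hle.trans (le_of_eq ?_)
    rw [← add_mul]
    norm_num
    congr 1
    ext π
    ring
  · refine le_of_eq ?_
    rw [← permMean_comp_mul (Equiv.swap a l)]
    congr 1
    ext π
    congr 1
    · simp
    · refine Finset.prod_congr rfl fun k hk => ?_
      have h1 : k ≠ l := fun h => hl (h ▸ hk)
      have h2 : k ≠ a := fun h => ha (h ▸ hk)
      simp [Equiv.swap_apply_of_ne_of_ne h2 h1]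

/-- Maclaurin's inequality: products over a sample without replacement are on average at most
the corresponding power of the mean. -/
lemma permMean_prod_le {y : Fin T → ℝ} (hy : ∀ i, 0 ≤ y i) (S : Finset (Fin T)) :
    permMean (fun π => ∏ k ∈ S, y (π k)) ≤ ((∑ i, y i) / T) ^ S.card := by
  induction S using Finset.induction_on with
  | empty => simp [permMean_const]
  | insert a S ha ih =>
    simp only [Finset.prod_insert ha, Finset.card_insert_of_notMem ha]
    refine (permMean_mul_prod_le hy ha).trans ?_
    rw [pow_succ']
    exact mul_le_mul_of_nonneg_left ih
      (div_nonneg (Finset.sum_nonneg fun i _ => hy i) (Nat.cast_nonneg _))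

lemma exp_mul_le_of_mem_Icc {x : ℝ} (hx : x ∈ Set.Icc (0 : ℝ) 1) (l : ℝ) :
    Real.exp (l * x) ≤ 1 + x * (Real.exp l - 1) := by
  have h := convexOn_exp.2 (Set.mem_univ 0) (Set.mem_univ l) (sub_nonneg.2 hx.2) hx.1 (by ring)
  simp only [smul_eq_mul, mul_zero, zero_add, Real.exp_zero, mul_one] at h
  rw [mul_comm l x]
  linarith

/-- `permMean_prod_le` for the numbers exp(l·x), followed by convexity of exp and 1 + u ≤ exp u: the
same bound as for sampling with replacement. -/
lemma permMean_exp_sum_le {x : Fin T → ℝ} (hx : ∀ i, x i ∈ Set.Icc (0 : ℝ) 1) (l : ℝ)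
    (S : Finset (Fin T)) :
    permMean (fun π => Real.exp (l * ∑ k ∈ S, x (π k))) ≤
      Real.exp (S.card * ((∑ i, x i) / T) * (Real.exp l - 1)) := by
  simp only [Finset.mul_sum, Real.exp_sum]
  refine (permMean_prod_le (y := fun i => Real.exp (l * x i)) (fun i => (Real.exp_pos _).le) S).trans
    ?_
  rw [mul_assoc, Real.exp_nat_mul]
  refine pow_le_pow_left₀ (div_nonneg (Finset.sum_nonneg fun i _ => (Real.exp_pos _).le)
    (Nat.cast_nonneg _)) ?_ _
  rcases Nat.eq_zero_or_pos T with rfl | hT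
  · simp
  have hT' : (0 : ℝ) < T := by exact_mod_cast hT
  have h1 : (∑ i, Real.exp (l * x i)) / T ≤ (∑ i, x i) / T * (Real.exp l - 1) + 1 := by
    rw [div_le_iff₀ hT']
    refine (Finset.sum_le_sum fun i _ => exp_mul_le_of_mem_Icc (hx i) l).trans (le_of_eq ?_)
    rw [Finset.sum_add_distrib, ← Finset.sum_mul]
    simp
    field_simp
    ring
  exact h1.trans (Real.add_one_le_exp _)

/-- Uses (1 - x + x²/2)(1 + x + x²/2) = 1 + x⁴/4. -/
lemma exp_neg_le_quadratic {x : ℝ} (hx : 0 ≤ x) : Real.exp (-x) ≤ 1 - x + x ^ 2 / 2 := by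
  have h1 := Real.quadratic_le_exp_of_nonneg hx
  rw [Real.exp_neg, inv_le_iff_one_le_mul₀ (Real.exp_pos _)]
  have h2 : 0 ≤ 1 - x + x ^ 2 / 2 := by nlinarith [sq_nonneg (x - 1)]
  nlinarith [mul_le_mul_of_nonneg_left h1 h2, sq_nonneg (x ^ 2)]

lemma exp_sub_one_le_of_abs_le_one {l : ℝ} (hl : |l| ≤ 1) :
    Real.exp l - 1 ≤ l + 3 / 4 * l ^ 2 := by
  have h := Real.exp_bound hl (n := 2) (by norm_num)
  simp [Finset.sum_range_succ] at h
  have := (abs_le.1 h).2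
  norm_num at this
  nlinarith [sq_abs l]

/-- Sub-gaussian upper tail bound in the range of small exponents. -/
lemma permMean_exp_sub_le {x : Fin T → ℝ} (hx : ∀ i, x i ∈ Set.Icc (0 : ℝ) 1) {l m : ℝ}
    (hl : |l| ≤ 1) (S : Finset (Fin T)) (hm : S.card * ((∑ i, x i) / T) ≤ m) :
    permMean (fun π => Real.exp (l * (∑ k ∈ S, x (π k) - S.card * ((∑ i, x i) / T)))) ≤
      Real.exp (3 / 4 * l ^ 2 * m) := by
  simp only [mul_sub, Real.exp_sub, div_eq_inv_mul _ (Real.exp _)]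
  rw [permMean_const_mul, ← div_eq_inv_mul, div_le_iff₀ (Real.exp_pos _), ← Real.exp_add]
  refine (permMean_exp_sum_le hx l S).trans (Real.exp_le_exp.2 ?_)
  have h0 : 0 ≤ S.card * ((∑ i, x i) / T) := mul_nonneg (Nat.cast_nonneg _)
    (div_nonneg (Finset.sum_nonneg fun i _ => (hx i).1) (Nat.cast_nonneg _))
  nlinarith [mul_le_mul_of_nonneg_left (exp_sub_one_le_of_abs_le_one hl) h0,
    mul_le_mul_of_nonneg_left hm (sq_nonneg l)]

/-- Chernoff bound for the upper tail of a sample without replacement. -/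
lemma permProb_upper_tail {x : Fin T → ℝ} (hx : ∀ i, x i ∈ Set.Icc (0 : ℝ) 1) {a m : ℝ}
    (S : Finset (Fin T)) (hm : S.card * ((∑ i, x i) / T) ≤ m) (hm0 : 0 < m) (ha : 0 ≤ a)
    (ham : a ≤ m) :
    permProb (fun π => S.card * ((∑ i, x i) / T) + a < ∑ k ∈ S, x (π k)) ≤
      Real.exp (-(a ^ 2 / (3 * m))) := by
  -- Minimizer of 3/4·l²·m - l·a. The condition a ≤ m keeps it below 1, where the quadratic bound on
  -- exp is available.
  set l : ℝ := 2 * a / (3 * m) with hldef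
  have hl0 : 0 ≤ l := by positivity
  have hl1 : l ≤ 1 := by
    rw [hldef, div_le_one (by positivity)]
    linarith
  have h1 : permProb (fun π => S.card * ((∑ i, x i) / T) + a < ∑ k ∈ S, x (π k)) ≤
      permMean (fun π => Real.exp (l * (∑ k ∈ S, x (π k) - S.card * ((∑ i, x i) / T)) - l * a)) := by
    rcases ha.eq_or_lt with rfl | ha'
    · have : l = 0 := by simp [hldef]
      simp only [this, zero_mul, sub_zero, Real.exp_zero]
      rw [permProb_eq_permMean]
      refine permMean_mono fun π => ?_
      split_ifs <;> norm_num
    · have hl : 0 < l := by positivity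
      refine (permProb_mono fun π h => ?_).trans (permProb_pos_le_exp _)
      rw [← mul_sub]
      exact mul_pos hl (by linarith)
  refine h1.trans ?_
  simp only [Real.exp_sub _ (l * a), div_eq_inv_mul _ (Real.exp _)]
  rw [permMean_const_mul, ← div_eq_inv_mul, div_le_iff₀ (Real.exp_pos _), ← Real.exp_add]
  refine (permMean_exp_sub_le hx (abs_le.2 ⟨by linarith, hl1⟩) S hm).trans
    (Real.exp_le_exp.2 (le_of_eq ?_))
  rw [hldef]
  field_simp
  ring

/-- Chernoff bound for the lower tail of a sample without replacement. -/
lemma permProb_lower_tail {x : Fin T → ℝ} (hx : ∀ i, x i ∈ Set.Icc (0 : ℝ) 1) {a m : ℝ}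
    (S : Finset (Fin T)) (hm : S.card * ((∑ i, x i) / T) = m) (hm0 : 0 < m) (ha : 0 < a) :
    permProb (fun π => ∑ k ∈ S, x (π k) < m - a) ≤ Real.exp (-(a ^ 2 / (2 * m))) := by
  -- The exponent a/m minimizes m·l²/2 - l·a.
  have hl : 0 < a / m := by positivity
  have h1 : permProb (fun π => ∑ k ∈ S, x (π k) < m - a) ≤
      permMean (fun π => Real.exp ((a / m) * (m - a)) *
        Real.exp ((-(a / m)) * ∑ k ∈ S, x (π k))) := by
    simp only [← Real.exp_add]
    refine (permProb_mono fun π h => ?_).trans (permProb_pos_le_exp _)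
    nlinarith [mul_lt_mul_of_pos_left h hl]
  refine h1.trans ?_
  rw [permMean_const_mul]
  refine (mul_le_mul_of_nonneg_left (permMean_exp_sum_le hx _ S) (Real.exp_pos _).le).trans ?_
  rw [hm, ← Real.exp_add, Real.exp_le_exp]
  have hq : Real.exp (-(a / m)) ≤ 1 - a / m + (a / m) ^ 2 / 2 :=
    exp_neg_le_quadratic hl.le
  have : a / m * (m - a) + m * (1 - a / m + (a / m) ^ 2 / 2 - 1) = -(a ^ 2 / (2 * m)) := by
    field_simp
    ring
  nlinarith [mul_le_mul_of_nonneg_left hq hm0.le]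

end PermMean


/-! ### Quantities that depend on the first requests only -/

section Prefix

variable {T : ℕ}

/-- `g π` is determined by `π 0, …, π (m - 1)`. -/
def DependsOnPrefix {α : Type*} (m : ℕ) (g : Equiv.Perm (Fin T) → α) : Prop :=
  ∀ π π' : Equiv.Perm (Fin T), (∀ k : Fin T, (k : ℕ) < m → π k = π' k) → g π = g π'

/-- The transposition of m and k leaves the positions before m alone, so all positions from m on are
exchangeable given the past. -/
lemma permMean_mul_apply_eq {g : Equiv.Perm (Fin T) → ℝ} {m : Fin T}
    (hg : DependsOnPrefix (m : ℕ) g) (x : Fin T → ℝ) {k : Fin T} (hk : m ≤ k) :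
    permMean (fun π => g π * x (π k)) = permMean (fun π => g π * x (π m)) := by
  rw [← permMean_comp_mul (Equiv.swap m k)]
  congr 1
  ext π
  congr 1
  · refine hg _ _ fun l hl => ?_
    have h1 : l ≠ m := fun h => by simp [h] at hl
    have h2 : l ≠ k := fun h => by
      rw [h] at hl
      exact absurd hl (not_lt.2 hk)
    simp [Equiv.swap_apply_of_ne_of_ne h1 h2]
  · simp

/-- Given the past, the next request is a uniformly random one of the remaining requests. -/
lemma permMean_mul_sum_Ici {g : Equiv.Perm (Fin T) → ℝ} {m : Fin T}
    (hg : DependsOnPrefix (m : ℕ) g) (x : Fin T → ℝ) :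
    permMean (fun π => g π * ∑ k ∈ Finset.Ici m, x (π k)) =
      ((T - (m : ℕ) : ℕ) : ℝ) * permMean (fun π => g π * x (π m)) := by
  simp only [Finset.mul_sum]
  rw [permMean_sum, Finset.sum_congr rfl fun k hk =>
    permMean_mul_apply_eq hg x (Finset.mem_Ici.1 hk), Finset.sum_const, Fin.card_Ici, nsmul_eq_mul]

/-- By exchangeability, x j (π m) may be replaced by the average over all remaining positions, whose
exponential moments do not involve g. The dependence of g on the past is then harmless: the weighted
sum is at most G times the worst coordinate, and the maximum over coordinates costs log (d + 1). -/
lemma permMean_sum_mul_sub_le {d : ℕ} {g : Fin d → Equiv.Perm (Fin T) → ℝ} {m : Fin T}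
    (hg : ∀ j, DependsOnPrefix (m : ℕ) (g j)) (hg0 : ∀ j π, 0 ≤ g j π) {G : ℝ}
    (hG : ∀ π, ∑ j, g j π ≤ G) (x : Fin d → Fin T → ℝ) (β : Fin d → ℝ) {l Q : ℝ} (hl : 0 < l)
    (hQ : 0 ≤ Q)
    (hmgf : ∀ j, permMean (fun π => Real.exp (l * (∑ k ∈ Finset.Ici m, x j (π k) -
      ((T - (m : ℕ) : ℕ) : ℝ) * β j))) ≤ Real.exp Q) :
    permMean (fun π => ∑ j, g j π * (x j (π m) - β j)) ≤
      G * (Real.log (d + 1) + 1 + Q) / (((T - (m : ℕ) : ℕ) : ℝ) * l) := by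
  set s : ℝ := ((T - (m : ℕ) : ℕ) : ℝ) with hs
  have hspos : 0 < s := by
    rw [hs]
    exact_mod_cast Nat.sub_pos_of_lt m.isLt
  set D : Fin d → Equiv.Perm (Fin T) → ℝ :=
    fun j π => l * (∑ k ∈ Finset.Ici m, x j (π k) - s * β j) with hD
  set c : ℝ := Real.log (d + 1) + Q with hc
  have hlog : 0 ≤ Real.log ((d : ℝ) + 1) := Real.log_nonneg (by linarith [(Nat.cast_nonneg d : (0:ℝ) ≤ d)])
  have hc0 : 0 ≤ c := add_nonneg hlog hQ
  have h1 : s * l * permMean (fun π => ∑ j, g j π * (x j (π m) - β j)) =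
      permMean (fun π => ∑ j, g j π * D j π) := by
    have h2 : ∀ j, permMean (fun π => g j π * D j π) =
        s * l * permMean (fun π => g j π * (x j (π m) - β j)) := by
      intro j
      have e1 : (fun π => g j π * D j π) = fun π =>
          l * (g j π * ∑ k ∈ Finset.Ici m, x j (π k)) - l * s * β j * g j π := by
        ext π
        simp only [hD]
        ring
      have e2 : (fun π => g j π * (x j (π m) - β j)) = fun π =>
          g j π * x j (π m) - β j * g j π := by
        ext π
        ring
      rw [e1, e2, permMean_sub, permMean_sub, permMean_const_mul, permMean_const_mul,
        permMean_mul_sum_Ici (hg j), permMean_const_mul]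
      ring
    rw [permMean_sum, permMean_sum, Finset.mul_sum]
    exact Finset.sum_congr rfl fun j _ => (h2 j).symm
  -- Soft maximum: D ≤ c + exp(D - c). With c = log (d + 1) + Q the exponentials of all coordinates
  -- together have mean at most 1.
  have hY : ∀ π, ∑ j, g j π * D j π ≤ G * (c + Real.exp (-c) * ∑ i, Real.exp (D i π)) := by
    intro π
    have hY0 : 0 ≤ c + Real.exp (-c) * ∑ i, Real.exp (D i π) :=
      add_nonneg hc0 (mul_nonneg (Real.exp_pos _).le
        (Finset.sum_nonneg fun i _ => (Real.exp_pos _).le))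
    calc ∑ j, g j π * D j π
        ≤ ∑ j, g j π * (c + Real.exp (-c) * ∑ i, Real.exp (D i π)) := by
          refine Finset.sum_le_sum fun j _ => mul_le_mul_of_nonneg_left ?_ (hg0 j π)
          have h3 : Real.exp (D j π) ≤ ∑ i, Real.exp (D i π) :=
            Finset.single_le_sum (f := fun i => Real.exp (D i π))
              (fun i _ => (Real.exp_pos _).le) (Finset.mem_univ j)
          have h4 := Real.add_one_le_exp (-c + D j π)
          rw [Real.exp_add] at h4
          nlinarith [mul_le_mul_of_nonneg_left h3 (Real.exp_pos (-c)).le]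
      _ = (∑ j, g j π) * (c + Real.exp (-c) * ∑ i, Real.exp (D i π)) := by rw [Finset.sum_mul]
      _ ≤ _ := mul_le_mul_of_nonneg_right (hG π) hY0
  have hG0 : 0 ≤ G := (Finset.sum_nonneg fun j _ => hg0 j 1).trans (hG 1)
  rw [le_div_iff₀ (by positivity), mul_comm, h1]
  refine (permMean_mono hY).trans ?_
  rw [permMean_const_mul, permMean_add, permMean_const, permMean_const_mul, permMean_sum]
  refine mul_le_mul_of_nonneg_left ?_ hG0
  have h5 : ∑ i, permMean (fun π => Real.exp (D i π)) ≤ d * Real.exp Q := by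
    refine (Finset.sum_le_sum fun i _ => hmgf i).trans ?_
    simp
  have h6 : Real.exp (-c) * (((d : ℝ) + 1) * Real.exp Q) = 1 := by
    have : ((d : ℝ) + 1) * Real.exp Q = Real.exp c := by
      rw [hc, Real.exp_add, Real.exp_log (by positivity)]
    rw [this, ← Real.exp_add]
    simp
  have h7 := mul_le_mul_of_nonneg_left h5 (Real.exp_pos (-c)).le
  have h8 : 0 < Real.exp (-c) * Real.exp Q := by positivity
  rw [hc] at *
  nlinarith

/-- Telescoping, from 1/√(u + 1) ≤ 2(√(u + 1) - √u). -/
lemma sum_inv_sqrt_le (T N : ℕ) (hN : N ≤ T) :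
    ∑ m ∈ Finset.range N, 1 / Real.sqrt ((T - m : ℕ) : ℝ) ≤
      2 * (Real.sqrt T - Real.sqrt ((T - N : ℕ) : ℝ)) := by
  induction N with
  | zero => simp
  | succ N ih =>
    rw [Finset.sum_range_succ]
    have h := ih (by omega)
    have hs : T - N = (T - (N + 1)) + 1 := by omega
    set u := T - (N + 1)
    rw [hs] at h ⊢
    have h1 : (0 : ℝ) < Real.sqrt ((u + 1 : ℕ) : ℝ) := Real.sqrt_pos.2 (by positivity)
    have h2 : Real.sqrt ((u : ℕ) : ℝ) ≤ Real.sqrt ((u + 1 : ℕ) : ℝ) :=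
      Real.sqrt_le_sqrt (by push_cast; linarith)
    have h3 : Real.sqrt ((u + 1 : ℕ) : ℝ) ^ 2 = u + 1 := by
      rw [Real.sq_sqrt (by positivity)]
      push_cast
      ring
    have h4 : Real.sqrt (u : ℝ) ^ 2 = u := Real.sq_sqrt (by positivity)
    have h5 : 1 / Real.sqrt ((u + 1 : ℕ) : ℝ) ≤
        2 * (Real.sqrt ((u + 1 : ℕ) : ℝ) - Real.sqrt (u : ℝ)) := by
      rw [div_le_iff₀ h1]
      nlinarith [sq_nonneg (Real.sqrt ((u + 1 : ℕ) : ℝ) - Real.sqrt (u : ℝ))]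
    linarith

variable {m : Fin T} {ε : ℝ}

/-- Choice of the exponent l = ε√T/√s when s requests remain: the variance term l²s = ε²T does not
depend on time, and s·l = ε√T√s makes the errors summable by `sum_inv_sqrt_le`. The requirement l ≤
1 is what forces the last ε²T steps to be given up. -/
lemma sampling_rate_bounds (hε : 0 < ε) (hm : ε ^ 2 * T ≤ ((T - (m : ℕ) : ℕ) : ℝ)) :
    0 < ε * Real.sqrt T / Real.sqrt ((T - (m : ℕ) : ℕ) : ℝ) ∧
    ε * Real.sqrt T / Real.sqrt ((T - (m : ℕ) : ℕ) : ℝ) ≤ 1 ∧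
    ((T - (m : ℕ) : ℕ) : ℝ) * (ε * Real.sqrt T / Real.sqrt ((T - (m : ℕ) : ℕ) : ℝ)) =
      ε * Real.sqrt T * Real.sqrt ((T - (m : ℕ) : ℕ) : ℝ) ∧
    (ε * Real.sqrt T / Real.sqrt ((T - (m : ℕ) : ℕ) : ℝ)) ^ 2 * ((T - (m : ℕ) : ℕ) : ℝ) =
      ε ^ 2 * T := by
  have hT : (0 : ℝ) < T := by exact_mod_cast m.pos
  have hs : (0 : ℝ) < ((T - (m : ℕ) : ℕ) : ℝ) := by exact_mod_cast Nat.sub_pos_of_lt m.isLt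
  set s : ℝ := ((T - (m : ℕ) : ℕ) : ℝ)
  have h1 : 0 < Real.sqrt s := Real.sqrt_pos.2 hs
  have h2 : 0 < Real.sqrt T := Real.sqrt_pos.2 hT
  have h3 : Real.sqrt s ^ 2 = s := Real.sq_sqrt hs.le
  have h4 : Real.sqrt T ^ 2 = T := Real.sq_sqrt hT.le
  refine ⟨by positivity, ?_, ?_, ?_⟩
  · rw [div_le_one h1]
    refine Real.le_sqrt_of_sq_le ?_
    rw [mul_pow, h4]
    exact hm
  · nth_rewrite 1 [← h3]
    field_simp
  · rw [div_pow, mul_pow, h3, h4]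
    field_simp

/-- Cost of the comparison options under prices that depend on the past only. -/
lemma permMean_price_mul_cost_le {d : ℕ} {g : Fin d → Equiv.Perm (Fin T) → ℝ}
    (hg : ∀ j, DependsOnPrefix (m : ℕ) (g j)) (hg0 : ∀ j π, 0 ≤ g j π) {G : ℝ}
    (hG : ∀ π, ∑ j, g j π ≤ G) {x : Fin d → Fin T → ℝ}
    (hx : ∀ j i, x j i ∈ Set.Icc (0 : ℝ) 1) {B : ℝ} (hB : 0 ≤ B) (hxB : ∀ j, ∑ i, x j i ≤ B)
    (hε : 0 < ε) (hm : ε ^ 2 * T ≤ ((T - (m : ℕ) : ℕ) : ℝ)) :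
    permMean (fun π => ∑ j, g j π * (x j (π m) - B / T)) ≤
      G * (Real.log (d + 1) + 1 + ε ^ 2 * B) /
        (ε * Real.sqrt T * Real.sqrt ((T - (m : ℕ) : ℕ) : ℝ)) := by
  obtain ⟨hl, hl1, hls, hlsq⟩ := sampling_rate_bounds hε hm
  rw [← hls]
  refine permMean_sum_mul_sub_le hg hg0 hG x (fun _ => B / T) hl (by positivity) fun j => ?_
  have hT : (0 : ℝ) < T := by exact_mod_cast m.pos
  set s : ℝ := ((T - (m : ℕ) : ℕ) : ℝ) with hs
  set l : ℝ := ε * Real.sqrt T / Real.sqrt s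
  have hs0 : 0 ≤ s := Nat.cast_nonneg _
  have hmean : s * ((∑ i, x j i) / T) ≤ s * (B / T) :=
    mul_le_mul_of_nonneg_left (div_le_div_of_nonneg_right (hxB j) hT.le) hs0
  have hcard : (((Finset.Ici m).card : ℕ) : ℝ) = s := by rw [Fin.card_Ici]
  have h := permMean_exp_sub_le (hx j) (abs_le.2 ⟨by linarith, hl1⟩) (Finset.Ici m)
    (m := s * (B / T)) (by rw [hcard]; exact hmean)
  rw [hcard] at h
  refine (permMean_mono fun π => Real.exp_le_exp.2 ?_).trans (h.trans (Real.exp_le_exp.2 ?_))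
  · exact mul_le_mul_of_nonneg_left (by linarith) hl.le
  · have : l ^ 2 * (s * (B / T)) = ε ^ 2 * B := by
      rw [← mul_assoc, hlsq]
      field_simp
    have h0 : 0 ≤ ε ^ 2 * B := by positivity
    linarith

/-- Reward of the comparison options, counted at times that depend on the past only. -/
lemma permMean_mul_mean_sub_reward_le {g : Equiv.Perm (Fin T) → ℝ}
    (hg : DependsOnPrefix (m : ℕ) g) (hg0 : ∀ π, 0 ≤ g π) (hg1 : ∀ π, g π ≤ 1)
    {r : Fin T → ℝ} (hr : ∀ i, r i ∈ Set.Icc (0 : ℝ) 1)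
    (hε : 0 < ε) (hm : ε ^ 2 * T ≤ ((T - (m : ℕ) : ℕ) : ℝ)) :
    permMean (fun π => g π * ((∑ i, r i) / T - r (π m))) ≤
      (2 + ε ^ 2 * ∑ i, r i) / (ε * Real.sqrt T * Real.sqrt ((T - (m : ℕ) : ℕ) : ℝ)) := by
  obtain ⟨hl, hl1, hls, hlsq⟩ := sampling_rate_bounds hε hm
  have hT : (0 : ℝ) < T := by exact_mod_cast m.pos
  have hR : 0 ≤ ∑ i, r i := Finset.sum_nonneg fun i _ => (hr i).1
  -- Rewards need the lower tail, hence one coordinate with -r in place of r; log 2 ≤ 1 gives the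
  -- constant 2.
  have key := permMean_sum_mul_sub_le (d := 1) (g := fun _ => g) (fun _ => hg) (fun _ => hg0)
    (G := 1) (fun π => by simpa using hg1 π) (fun _ i => - r i) (fun _ => -((∑ i, r i) / T)) hl
    (Q := ε ^ 2 * ∑ i, r i) (by positivity) ?_
  · simp only [Fin.sum_univ_one, sub_neg_eq_add, Nat.cast_one, one_mul, neg_add_eq_sub] at key
    refine key.trans ?_
    rw [hls]
    refine div_le_div_of_nonneg_right ?_ (by positivity)
    have := Real.log_two_lt_d9
    rw [one_add_one_eq_two]
    linarith
  · intro _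
    set s : ℝ := ((T - (m : ℕ) : ℕ) : ℝ) with hs
    set l : ℝ := ε * Real.sqrt T / Real.sqrt s
    have hcard : (((Finset.Ici m).card : ℕ) : ℝ) = s := by rw [Fin.card_Ici]
    have h := permMean_exp_sub_le hr (l := -l) (by rw [abs_neg]; exact abs_le.2 ⟨by linarith, hl1⟩)
      (Finset.Ici m) le_rfl
    rw [hcard] at h
    refine (permMean_mono fun π => Real.exp_le_exp.2 (le_of_eq ?_)).trans
      (h.trans (Real.exp_le_exp.2 ?_))
    · rw [Finset.sum_neg_distrib]
      ring
    · have : (-l) ^ 2 * (s * ((∑ i, r i) / T)) = ε ^ 2 * ∑ i, r i := by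
        rw [neg_sq, ← mul_assoc, hlsq]
        field_simp
      have h0 : 0 ≤ ε ^ 2 * ∑ i, r i := by positivity
      linarith

end Prefix


/-! ### Projections of computations with operation counts -/

namespace Counted

variable {α β : Type}

@[simp] lemma pure_val (a : α) : (pure a : Counted α).val = a := rfl
@[simp] lemma pure_arith (a : α) : (pure a : Counted α).arith = 0 := rfl
@[simp] lemma pure_linMax (a : α) : (pure a : Counted α).linMax = 0 := rfl
@[simp] lemma pure_lp (a : α) : (pure a : Counted α).lp = 0 := rfl
@[simp] lemma bind_val (x : Counted α) (f : α → Counted β) : (x >>= f).val = (f x.val).val := rfl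
@[simp] lemma bind_arith (x : Counted α) (f : α → Counted β) :
    (x >>= f).arith = x.arith + (f x.val).arith := rfl
@[simp] lemma bind_linMax (x : Counted α) (f : α → Counted β) :
    (x >>= f).linMax = x.linMax + (f x.val).linMax := rfl
@[simp] lemma bind_lp (x : Counted α) (f : α → Counted β) :
    (x >>= f).lp = x.lp + (f x.val).lp := rfl

end Counted

/-! ### The course of the packing algorithm on a fixed sequence of requests -/

section Path

variable {d : ℕ} (pick : Set (Choice d) → (Fin d → ℝ) → Choice d) (B : ℝ) (T : ℕ) (ε Z : ℝ)

lemma packingStep_val_of_exited {s : Memory d} (h : s.exited = true) (A : Set (Choice d)) :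
    (packingStep pick B T ε Z s A).val = (s, 0) := by
  simp [packingStep, h]

lemma packingStep_val_of_full {s : Memory d} (h : s.exited = false) {A : Set (Choice d)}
    (hf : ∃ j, B ≤ s.load j + (pick A fun j => Z * s.θ j).2 j) :
    (packingStep pick B T ε Z s A).val = ({ s with exited := true }, 0) := by
  simp [packingStep, h, Counted.vec, Counted.op, Counted.maximize, Counted.anyGe, hf]

lemma packingStep_val_of_not_full {s : Memory d} (h : s.exited = false) {A : Set (Choice d)}
    (hf : ¬ ∃ j, B ≤ s.load j + (pick A fun j => Z * s.θ j).2 j) :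
    (packingStep pick B T ε Z s A).val =
      (⟨fun j => s.w j * (1 + ε) ^ ((pick A fun j => Z * s.θ j).2 j - B / T),
        fun j => s.w j * (1 + ε) ^ ((pick A fun j => Z * s.θ j).2 j - B / T) /
          (1 + ∑ i, s.w i * (1 + ε) ^ ((pick A fun j => Z * s.θ j).2 i - B / T)),
        fun j => s.load j + (pick A fun j => Z * s.θ j).2 j, false⟩,
        pick A fun j => Z * s.θ j) := by
  simp [packingStep, h, Counted.vec, Counted.op, Counted.maximize, Counted.anyGe, Counted.sum, hf]

variable (A : ℕ → Set (Choice d))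

/-- Memory of the packing algorithm after `t` requests. -/
def packingState (t : ℕ) : Memory d := (packingAlg pick B T ε Z).state A t

/-- The option that maximizes the reward minus the price of the costs at time `t`. -/
def packingChoice (t : ℕ) : Choice d :=
  pick (A t) fun j => Z * (packingState pick B T ε Z A t).θ j

/-- `1` before the exit, `0` afterwards. -/
def packingActive (t : ℕ) : ℝ := if (packingState pick B T ε Z A t).exited then 0 else 1

local notation "st" => packingState pick B T ε Z A
local notation "ch" => packingChoice pick B T ε Z A
local notation "ac" => packingActive pick B T ε Z A
local notation "pl" => Alg.played (packingAlg pick B T ε Z) A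

lemma packingState_zero : st 0 = initMemory d := rfl

lemma packingState_succ (t : ℕ) : st (t + 1) = (packingStep pick B T ε Z (st t) (A t)).val.1 := rfl

lemma packing_played (t : ℕ) : pl t = (packingStep pick B T ε Z (st t) (A t)).val.2 := rfl

/-- The three kinds of steps: after the exit, at the exit, and ordinary. The inductions along a run
split into these cases, and only the last one changes weights and loads. -/
lemma packing_cases (t : ℕ) :
    ((st t).exited = true ∧ st (t + 1) = st t ∧ pl t = 0) ∨
    ((st t).exited = false ∧ (∃ j, B ≤ (st t).load j + (ch t).2 j) ∧
      st (t + 1) = { st t with exited := true } ∧ pl t = 0) ∨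
    ((st t).exited = false ∧ (∀ j, (st t).load j + (ch t).2 j < B) ∧ pl t = ch t ∧
      (st (t + 1)).exited = false ∧
      (∀ j, (st (t + 1)).w j = (st t).w j * (1 + ε) ^ ((ch t).2 j - B / T)) ∧
      (∀ j, (st (t + 1)).θ j = (st (t + 1)).w j / (1 + ∑ i, (st (t + 1)).w i)) ∧
      ∀ j, (st (t + 1)).load j = (st t).load j + (ch t).2 j) := by
  rw [packingState_succ, packing_played]
  cases h : (st t).exited
  · by_cases hf : ∃ j, B ≤ (st t).load j + (ch t).2 j
    · right; left
      rw [packingStep_val_of_full pick B T ε Z h hf]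
      exact ⟨rfl, hf, rfl, rfl⟩
    · right; right
      rw [packingStep_val_of_not_full pick B T ε Z h hf]
      push Not at hf
      exact ⟨rfl, hf, rfl, rfl, fun _ => rfl, fun _ => rfl, fun _ => rfl⟩
  · left
    rw [packingStep_val_of_exited pick B T ε Z h]
    exact ⟨rfl, rfl, rfl⟩

variable {B T ε Z}

lemma packing_weights (hε : 0 < ε) (t : ℕ) :
    (∀ j, 0 < (st t).w j) ∧ ∀ j, (st t).θ j = (st t).w j / (1 + ∑ i, (st t).w i) := by
  induction t with
  | zero =>
    rw [packingState_zero]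
    simp [initMemory, add_comm]
  | succ t ih =>
    rcases packing_cases pick B T ε Z A t with ⟨-, h, -⟩ | ⟨-, -, h, -⟩ | ⟨-, -, -, -, h, hθ, -⟩
    · rw [h]
      exact ih
    · rw [h]
      exact ih
    · refine ⟨fun j => ?_, hθ⟩
      rw [h]
      exact mul_pos (ih.1 j) (Real.rpow_pos_of_pos (by linarith) _)

lemma packing_sum_weights_nonneg (hε : 0 < ε) (t : ℕ) : 0 ≤ ∑ i, (st t).w i :=
  Finset.sum_nonneg fun i _ => ((packing_weights pick A hε t).1 i).le

lemma packing_dual_nonneg (hε : 0 < ε) (t : ℕ) (j : Fin d) : 0 ≤ (st t).θ j := by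
  rw [(packing_weights pick A hε t).2]
  have := packing_sum_weights_nonneg pick A (B := B) (T := T) (Z := Z) hε t
  exact div_nonneg ((packing_weights pick A hε t).1 j).le (by linarith)

/-- The summand 1 in the denominator of θ acts as the constant weight of a dummy coordinate without
cost; it is also what admits x = 0 in `packing_regret`. -/
lemma packing_sum_dual_le (hε : 0 < ε) (t : ℕ) : ∑ j, (st t).θ j ≤ 1 := by
  have := packing_sum_weights_nonneg pick A (B := B) (T := T) (Z := Z) hε t
  simp only [(packing_weights pick A hε t).2]
  rw [← Finset.sum_div, div_le_one (by linarith)]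
  linarith

lemma packing_price_nonneg (hε : 0 < ε) (hZ : 0 ≤ Z) (t : ℕ) (j : Fin d) :
    0 ≤ Z * (st t).θ j :=
  mul_nonneg hZ (packing_dual_nonneg pick A hε t j)

/-- The exit test precedes the play, so loads stay strictly below B. This is the budget half of
feasibility. -/
lemma packing_load (hB : 0 < B) (t : ℕ) (j : Fin d) :
    (st t).load j = ∑ k ∈ Finset.range t, (pl k).2 j ∧ (st t).load j < B := by
  induction t with
  | zero =>
    rw [packingState_zero]
    simp [initMemory, hB]
  | succ t ih =>
    rw [Finset.sum_range_succ, ← ih.1]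
    rcases packing_cases pick B T ε Z A t with ⟨-, h, hp⟩ | ⟨-, -, h, hp⟩ | ⟨-, hlt, hp, -, -, -, h⟩
    · rw [h, hp]
      simpa using ih.2
    · rw [h, hp]
      simpa using ih.2
    · rw [h, hp]
      exact ⟨rfl, hlt j⟩

lemma packing_played_mem (hε : 0 < ε) (hZ : 0 ≤ Z) (t : ℕ) (h0 : (0 : Choice d) ∈ A t)
    (hpick : ∀ p : Fin d → ℝ, (∀ j, 0 ≤ p j) → pick (A t) p ∈ A t) : pl t ∈ A t := by
  rcases packing_cases pick B T ε Z A t with ⟨-, -, hp⟩ | ⟨-, -, -, hp⟩ | ⟨-, -, hp, -⟩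
  · rwa [hp]
  · rwa [hp]
  · rw [hp]
    exact hpick _ (packing_price_nonneg pick A hε hZ t)

lemma packingActive_nonneg (t : ℕ) : 0 ≤ ac t := by
  rw [packingActive]
  split_ifs <;> norm_num

lemma packingActive_le_one (t : ℕ) : ac t ≤ 1 := by
  rw [packingActive]
  split_ifs <;> norm_num

/-- The option chosen at the exit counts as active but is discarded; this happens at most once and
costs at most 1. -/
lemma packing_reward {N : ℕ} (hch : ∀ t < N, (ch t).1 ∈ Set.Icc (0 : ℝ) 1) :
    ∑ t ∈ Finset.range N, ac t * (ch t).1 - 1 ≤ ∑ t ∈ Finset.range N, (pl t).1 := by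
  -- The indicator of the exit records whether the loss of 1 has already been incurred.
  have key : ∀ t ≤ N, ∑ k ∈ Finset.range t, ac k * (ch k).1 -
      (if (st t).exited then 1 else 0) ≤ ∑ k ∈ Finset.range t, (pl k).1 := by
    intro t
    induction t with
    | zero => simp [packingState_zero, initMemory]
    | succ t ih =>
      intro ht
      have ih := ih (by omega)
      rw [Finset.sum_range_succ, Finset.sum_range_succ]
      rcases packing_cases pick B T ε Z A t with ⟨he, h, hp⟩ | ⟨he, -, h, hp⟩ | ⟨he, -, hp, h, -⟩
      · rw [hp, h]
        simp only [packingActive, he] at ih ⊢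
        simpa using ih
      · have := (hch t (by omega)).2
        rw [hp, h]
        simp only [he, Bool.false_eq_true, if_false, sub_zero] at ih
        have ha : ac t = 1 := by simp [packingActive, he]
        rw [ha]
        simp only [if_true, Prod.fst_zero]
        linarith
      · rw [hp, h]
        have ha : ac t = 1 := by simp [packingActive, he]
        rw [ha]
        simp only [he, Bool.false_eq_true, if_false, sub_zero] at ih ⊢
        linarith
  refine le_trans ?_ (key N le_rfl)
  split_ifs <;> linarith

/-- Growth of one weight in one step. -/
lemma one_add_rpow_sub_le (hε : 0 < ε) {v b : ℝ} (hv : v ∈ Set.Icc (0 : ℝ) 1) (hb : 0 ≤ b) :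
    (1 + ε) ^ (v - b) ≤ 1 + (ε * v - Real.log (1 + ε) * b) / (1 + Real.log (1 + ε) * b) := by
  have h1 : (0 : ℝ) < 1 + ε := by linarith
  have hc : 0 ≤ Real.log (1 + ε) := Real.log_nonneg (by linarith)
  have hD : 0 < 1 + Real.log (1 + ε) * b := by positivity
  have e : 1 + (ε * v - Real.log (1 + ε) * b) / (1 + Real.log (1 + ε) * b) =
      (1 + ε * v) / (1 + Real.log (1 + ε) * b) := by
    field_simp
    ring
  rw [e, Real.rpow_sub h1]
  -- Numerator: Bernoulli's inequality for an exponent in [0,1]. Denominator: 1 + u ≤ exp u.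
  refine div_le_div₀ (by have := hv.1; positivity) ?_ hD ?_
  · have := rpow_one_add_le_one_add_mul_self (s := ε) (by linarith) hv.1 hv.2
    linarith
  · rw [Real.rpow_def_of_pos h1]
    have := Real.add_one_le_exp (Real.log (1 + ε) * b)
    linarith

/-- The multiplicative weight update keeps track of the accumulated cost. -/
lemma packing_potential (hε : 0 < ε) (hB : 0 < B) {N : ℕ}
    (hch : ∀ t < N, ∀ j, (ch t).2 j ∈ Set.Icc (0 : ℝ) 1) (t : ℕ) (ht : t ≤ N)
    (hex : (st t).exited = false) :
    (∀ k ≤ t, (st k).exited = false) ∧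
    (∀ j, (st t).w j = (1 + ε) ^ ((st t).load j - t * (B / T))) ∧
    (1 + Real.log (1 + ε) * (B / T)) * (Real.log (1 + ∑ j, (st t).w j) - Real.log (d + 1)) ≤
      ∑ k ∈ Finset.range t, ∑ j, (st k).θ j * (ε * (ch k).2 j - Real.log (1 + ε) * (B / T)) := by
  have h1 : (0 : ℝ) < 1 + ε := by linarith
  have hb : 0 ≤ B / T := by positivity
  have hc : 0 ≤ Real.log (1 + ε) := Real.log_nonneg (by linarith)
  set b := B / T with hbdef
  have hD : 0 < 1 + Real.log (1 + ε) * b := by positivity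
  induction t with
  | zero =>
    refine ⟨fun k hk => ?_, ?_, ?_⟩
    · rwa [Nat.le_zero.1 hk]
    · rw [packingState_zero]
      simp [initMemory]
    · rw [packingState_zero]
      simp [initMemory, add_comm]
  | succ t ih =>
    rcases packing_cases pick B T ε Z A t with ⟨he, h, -⟩ | ⟨-, -, h, -⟩ | ⟨he, -, -, -, hw, -, hld⟩
    · rw [h, he] at hex
      simp at hex
    · rw [h] at hex
      simp at hex
    obtain ⟨ih1, ih2, ih3⟩ := ih (by omega) he
    refine ⟨fun k hk => ?_, fun j => ?_, ?_⟩
    · rcases Nat.lt_or_ge k (t + 1) with h | h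
      · exact ih1 k (by omega)
      · rwa [le_antisymm hk h]
    · rw [hw, hld, ih2, ← Real.rpow_add h1]
      congr 1
      push_cast
      ring
    · rw [Finset.sum_range_succ]
      obtain ⟨hwpos, hθ⟩ := packing_weights pick A (B := B) (T := T) (Z := Z) hε t
      have hW : 0 < 1 + ∑ i, (st t).w i := by
        have := packing_sum_weights_nonneg pick A (B := B) (T := T) (Z := Z) hε t
        linarith
      have hW' : 0 < 1 + ∑ i, (st (t + 1)).w i := by
        have := packing_sum_weights_nonneg pick A (B := B) (T := T) (Z := Z) hε (t + 1)
        linarith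
      set X := ∑ j, (st t).θ j * (ε * (ch t).2 j - Real.log (1 + ε) * b) with hX
      -- Since θ is w divided by 1 + ∑ w, averaging the growth bounds of the weights produces
      -- exactly X; the dummy summand 1 does not grow.
      have hgrow : 1 + ∑ i, (st (t + 1)).w i ≤
          (1 + ∑ i, (st t).w i) * (1 + X / (1 + Real.log (1 + ε) * b)) := by
        have e1 : (1 + ∑ i, (st t).w i) * (X / (1 + Real.log (1 + ε) * b)) =
            ∑ j, (st t).w j * ((ε * (ch t).2 j - Real.log (1 + ε) * b) /
              (1 + Real.log (1 + ε) * b)) := by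
          rw [hX, ← mul_div_assoc, Finset.mul_sum, Finset.sum_div]
          refine Finset.sum_congr rfl fun j _ => ?_
          rw [hθ]
          field_simp
        rw [mul_add, mul_one, e1, add_assoc, ← Finset.sum_add_distrib]
        refine add_le_add le_rfl (Finset.sum_le_sum fun j _ => ?_)
        rw [hw]
        have := mul_le_mul_of_nonneg_left
          (one_add_rpow_sub_le hε (hch t (by omega) j) hb) (hwpos j).le
        linarith
      have hlog : Real.log (1 + ∑ i, (st (t + 1)).w i) - Real.log (1 + ∑ i, (st t).w i) ≤
          X / (1 + Real.log (1 + ε) * b) := by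
        rw [← Real.log_div hW'.ne' hW.ne']
        refine (Real.log_le_sub_one_of_pos (by positivity)).trans ?_
        rw [sub_le_iff_le_add, div_le_iff₀ hW]
        linarith
      rw [le_div_iff₀ hD] at hlog
      nlinarith

/-- Regret bound for the dual vectors. -/
lemma packing_regret (hε : 0 < ε) (hB : 0 < B) {N : ℕ}
    (hch : ∀ t < N, ∀ j, (ch t).2 j ∈ Set.Icc (0 : ℝ) 1) (t : ℕ) (ht : t ≤ N) (htT : t ≤ T)
    (hT : 0 < T) (hex : (st t).exited = false) {x : ℝ}
    (hx : x = 0 ∨ ∃ j, x = (st t).load j - t * (B / T)) (hxB : x ≤ B) :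
    x - ((1 / ε + B / T) * Real.log (d + 1) + ε * B) ≤
      ∑ k ∈ Finset.range t, ∑ j, (st k).θ j * ((ch k).2 j - B / T) := by
  obtain ⟨-, hw, hpot⟩ := packing_potential pick A hε hB hch t ht hex
  have h1 : (0 : ℝ) < 1 + ε := by linarith
  have hT' : (0 : ℝ) < T := by exact_mod_cast hT
  set c := Real.log (1 + ε) with hcdef
  have hc : 0 ≤ c := Real.log_nonneg (by linarith)
  have hcε : c ≤ ε := by
    have := Real.log_le_sub_one_of_pos h1
    linarith
  have hcε2 : ε - ε ^ 2 / 2 ≤ c := by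
    rcases le_or_gt ε 2 with h2 | h2
    · have h3 := Real.le_log_one_add_of_nonneg hε.le
      refine le_trans ?_ h3
      rw [le_div_iff₀ (by linarith)]
      nlinarith [pow_pos hε 3]
    · nlinarith
  have hL : 0 ≤ Real.log ((d : ℝ) + 1) :=
    Real.log_nonneg (by linarith [(Nat.cast_nonneg d : (0 : ℝ) ≤ d)])
  set b := B / T with hbdef
  have hb : 0 < b := by positivity
  have hbT : b * T = B := by rw [hbdef]; field_simp
  have hW0 := packing_sum_weights_nonneg pick A (B := B) (T := T) (Z := Z) hε t
  set S := ∑ k ∈ Finset.range t, ∑ j, (st k).θ j * ((ch k).2 j - b) with hS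
  set Θ := ∑ k ∈ Finset.range t, ∑ j, (st k).θ j with hΘ
  -- The potential compares ε·v with log(1 + ε)·b. Passing to a common factor ε costs at most ε²B/2,
  -- as the dual vectors sum to at most T over the run.
  have hsplit : ∑ k ∈ Finset.range t, ∑ j, (st k).θ j * (ε * (ch k).2 j - c * b) =
      ε * S + (ε - c) * b * Θ := by
    rw [hS, hΘ, Finset.mul_sum, Finset.mul_sum, ← Finset.sum_add_distrib]
    refine Finset.sum_congr rfl fun k _ => ?_
    rw [Finset.mul_sum, Finset.mul_sum, ← Finset.sum_add_distrib]
    refine Finset.sum_congr rfl fun j _ => ?_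
    ring
  have hΘT : Θ ≤ T := by
    calc Θ ≤ ∑ k ∈ Finset.range t, (1 : ℝ) :=
          Finset.sum_le_sum fun k _ => packing_sum_dual_le pick A hε k
      _ = t := by simp
      _ ≤ T := by exact_mod_cast htT
  have hΘ2 : (ε - c) * b * Θ ≤ ε ^ 2 / 2 * B := by
    calc (ε - c) * b * Θ ≤ (ε - c) * b * T :=
          mul_le_mul_of_nonneg_left hΘT (mul_nonneg (by linarith) hb.le)
      _ = (ε - c) * B := by rw [mul_assoc, hbT]
      _ ≤ _ := mul_le_mul_of_nonneg_right (by linarith) hB.le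
  rw [hsplit] at hpot
  have hlogW : 0 ≤ Real.log (1 + ∑ j, (st t).w j) := Real.log_nonneg (by linarith)
  -- A single weight, or the dummy summand 1 if x = 0, bounds the total from below.
  have hcx : c * x ≤ Real.log (1 + ∑ j, (st t).w j) := by
    rcases hx with rfl | ⟨j, hj⟩
    · simpa using hlogW
    · have h5 : (1 + ε) ^ x ≤ 1 + ∑ j, (st t).w j := by
        rw [hj, ← hw j]
        have := Finset.single_le_sum (f := fun i => (st t).w i)
          (fun i _ => ((packing_weights pick A hε t).1 i).le) (Finset.mem_univ j)
        linarith
      have h6 := Real.log_le_log (Real.rpow_pos_of_pos h1 x) h5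
      rw [Real.log_rpow h1] at h6
      linarith
  have h7 : Real.log (1 + ∑ j, (st t).w j) ≤ (1 + c * b) * Real.log (1 + ∑ j, (st t).w j) := by
    nlinarith [mul_nonneg (mul_nonneg hc hb.le) hlogW]
  have h8 : (1 + c * b) * Real.log ((d : ℝ) + 1) ≤ (1 + ε * b) * Real.log ((d : ℝ) + 1) :=
    mul_le_mul_of_nonneg_right (by nlinarith) hL
  -- Replaces log(1 + ε)·x by ε·x; this costs another ε²B/2 because x ≤ B.
  have h9 : ε * x - ε ^ 2 / 2 * B ≤ Real.log (1 + ∑ j, (st t).w j) := by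
    rcases le_or_gt x 0 with hx0 | hx0
    · have : 0 ≤ ε ^ 2 / 2 * B := by positivity
      nlinarith
    · nlinarith [mul_le_mul_of_nonneg_right hcε2 hx0.le,
        mul_le_mul_of_nonneg_left hxB (show 0 ≤ ε ^ 2 / 2 by positivity)]
  have h10 : ε * (x - ((1 / ε + b) * Real.log (d + 1) + ε * B)) =
      ε * x - (1 + ε * b) * Real.log (d + 1) - ε ^ 2 * B := by
    field_simp
    ring
  have h11 : ε * (x - ((1 / ε + b) * Real.log (d + 1) + ε * B)) ≤ ε * S := by
    rw [h10]
    linarith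
  exact le_of_mul_le_mul_left h11 hε

/-- The active steps, valued at the average reward and corrected by the price of the costs,
are worth almost as much as all steps. -/
lemma packing_value (hε : 0 < ε) (hB : 0 < B) (hT : 0 < T) (hZ : 0 ≤ Z) {N : ℕ} (hN : N ≤ T)
    (hch : ∀ t < N, ∀ j, (ch t).2 j ∈ Set.Icc (0 : ℝ) 1) {ρ : ℝ} (hρ : 0 ≤ ρ)
    (hZρ : ρ * T ≤ Z * B) :
    ρ * N - Z * ((1 / ε + B / T) * Real.log (d + 1) + ε * B + 1 + B / T) ≤
      ∑ t ∈ Finset.range N, ac t * (ρ + Z * ∑ j, (st t).θ j * ((ch t).2 j - B / T)) := by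
  have hT' : (0 : ℝ) < T := by exact_mod_cast hT
  have hb : 0 < B / T := by positivity
  have hbT : B / T * T = B := by field_simp
  have hsum : ∀ t, (st t).exited = false → t ≤ N →
      ∑ k ∈ Finset.range t, ac k * (ρ + Z * ∑ j, (st k).θ j * ((ch k).2 j - B / T)) =
        ρ * t + Z * ∑ k ∈ Finset.range t, ∑ j, (st k).θ j * ((ch k).2 j - B / T) := by
    intro t hex ht
    have h := (packing_potential pick A hε hB hch t ht hex).1
    have e : ρ * t = ∑ _k ∈ Finset.range t, ρ := by simp [mul_comm]
    rw [Finset.mul_sum, e, ← Finset.sum_add_distrib]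
    refine Finset.sum_congr rfl fun k hk => ?_
    have : ac k = 1 := by simp [packingActive, h k (Finset.mem_range.1 hk).le]
    rw [this, one_mul]
  -- After an exit the bound holds with T in place of N: the prices collected for the filled
  -- coordinate make up for all lost steps.
  have hexit : ∀ t ≤ N, (st t).exited = true →
      ρ * T - Z * ((1 / ε + B / T) * Real.log (d + 1) + ε * B + 1 + B / T) ≤
        ∑ k ∈ Finset.range t, ac k * (ρ + Z * ∑ j, (st k).θ j * ((ch k).2 j - B / T)) := by
    intro t
    induction t with
    | zero => simp [packingState_zero, initMemory]
    | succ t ih =>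
      intro ht hex
      rw [Finset.sum_range_succ]
      rcases packing_cases pick B T ε Z A t with ⟨he, -, -⟩ | ⟨he, ⟨j, hj⟩, -⟩ | ⟨-, -, -, h, -⟩
      · have ha : ac t = 0 := by simp [packingActive, he]
        rw [ha, zero_mul, add_zero]
        exact ih (by omega) he
      · have ha : ac t = 1 := by simp [packingActive, he]
        rw [ha, one_mul, hsum t he (by omega)]
        have hload := (packing_load pick A (T := T) (ε := ε) (Z := Z) hB t j).2
        have htb : 0 ≤ t * (B / T) := by positivity
        have hreg := packing_regret pick A hε hB hch t (by omega) (by omega) hT he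
          (Or.inr ⟨j, rfl⟩) (by linarith)
        have hv := (hch t (by omega) j).2
        -- The exit step still counts as active and is not covered by the regret bound up to time t.
        have hlast : -(B / T) ≤ ∑ j, (st t).θ j * ((ch t).2 j - B / T) := by
          calc -(B / T) ≤ (∑ j, (st t).θ j) * (-(B / T)) := by
                nlinarith [packing_sum_dual_le pick A (B := B) (T := T) (Z := Z) hε t]
            _ = ∑ j, (st t).θ j * (-(B / T)) := by rw [Finset.sum_mul]
            _ ≤ _ := Finset.sum_le_sum fun j _ =>
                mul_le_mul_of_nonneg_left (by linarith [(hch t (by omega) j).1])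
                  (packing_dual_nonneg pick A hε t j)
        have h1 := mul_le_mul_of_nonneg_left hreg hZ
        have h2 := mul_le_mul_of_nonneg_left hlast hZ
        -- One cost is at most 1, so the load before the exit step was at least B - 1.
        have h3 : Z * (B - 1 - t * (B / T)) ≤ Z * ((st t).load j - t * (B / T)) :=
          mul_le_mul_of_nonneg_left (by linarith) hZ
        -- Both sides are those of ρT ≤ ZB, scaled by the remaining fraction 1 - t/T.
        have h4 : ρ * (T - t) ≤ Z * (B - t * (B / T)) := by
          have e : Z * (B - t * (B / T)) = Z * B * (1 - t / T) := by field_simp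
          have e' : ρ * (T - t) = ρ * T * (1 - t / T) := by field_simp
          rw [e, e']
          refine mul_le_mul_of_nonneg_right hZρ ?_
          rw [sub_nonneg, div_le_one hT']
          exact_mod_cast (by omega : t ≤ T)
        linarith
      · rw [h] at hex
        simp at hex
  cases hex : (st N).exited
  · rw [hsum N hex le_rfl]
    -- Without an exit no step is lost, and comparison with the dummy coordinate suffices.
    have hreg := packing_regret pick A hε hB hch N le_rfl hN hT hex (Or.inl rfl) hB.le
    have h1 := mul_le_mul_of_nonneg_left hreg hZ
    have h2 : 0 ≤ Z * (1 + B / T) := by positivity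
    linarith
  · refine le_trans ?_ (hexit N le_rfl hex)
    have : ρ * N ≤ ρ * T := mul_le_mul_of_nonneg_left (by exact_mod_cast hN) hρ
    linarith

end Path


/-! ### The offline benchmark -/

section Benchmark

variable {d T : ℕ} (P : Instance d T)

/-- One option per request, within the budget. -/
def Instance.IsFeasible (c : Fin T → Choice d) : Prop :=
  (∀ i, c i ∈ P.X i) ∧ ∀ j, ∑ i, (c i).2 j ≤ P.B

variable {P}

lemma sum_reward_le {c : Fin T → Choice d} (hc : ∀ i, c i ∈ P.X i) : ∑ i, (c i).1 ≤ T := by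
  calc ∑ i, (c i).1 ≤ ∑ _i : Fin T, (1 : ℝ) :=
        Finset.sum_le_sum fun i _ => (P.reward_mem i _ (hc i)).2
    _ = T := by simp

lemma OPT_bddAbove : BddAbove {x | ∃ c : Fin T → Choice d, (∀ i, c i ∈ P.X i) ∧
    (∀ j, ∑ i, (c i).2 j ≤ P.B) ∧ x = (∑ i, (c i).1) / T} := by
  refine ⟨1, ?_⟩
  rintro x ⟨c, hc, -, rfl⟩
  exact div_le_one_of_le₀ (sum_reward_le hc) (Nat.cast_nonneg _)

lemma OPT_nonempty : {x | ∃ c : Fin T → Choice d, (∀ i, c i ∈ P.X i) ∧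
    (∀ j, ∑ i, (c i).2 j ≤ P.B) ∧ x = (∑ i, (c i).1) / T}.Nonempty :=
  ⟨_, fun _ => 0, P.zero_mem, fun j => by simpa using P.B_pos.le, rfl⟩

lemma OPT_nonneg : 0 ≤ P.OPT := by
  refine le_csSup OPT_bddAbove ⟨fun _ => 0, P.zero_mem, fun j => ?_, ?_⟩
  · simpa using P.B_pos.le
  · simp

lemma OPT_le_one : P.OPT ≤ 1 := by
  refine csSup_le OPT_nonempty ?_
  rintro x ⟨c, hc, -, rfl⟩
  exact div_le_one_of_le₀ (sum_reward_le hc) (Nat.cast_nonneg _)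

lemma mul_OPT_le : T * P.OPT ≤ T := by
  have := OPT_le_one (P := P)
  have : (0 : ℝ) ≤ T := Nat.cast_nonneg _
  nlinarith

lemma sum_reward_le_OPT {c : Fin T → Choice d} (hc : P.IsFeasible c) :
    ∑ i, (c i).1 ≤ T * P.OPT := by
  rcases Nat.eq_zero_or_pos T with rfl | hT
  · simp
  have hT' : (0 : ℝ) < T := by exact_mod_cast hT
  rw [← div_le_iff₀' hT']
  exact le_csSup OPT_bddAbove ⟨c, hc.1, hc.2, rfl⟩

/-- The supremum in `OPT` need not be attained, so the comparison choices are only near-optimal. -/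
lemma exists_feasible_of_lt_OPT {x : ℝ} (hx : x < T * P.OPT) :
    ∃ c : Fin T → Choice d, P.IsFeasible c ∧ x < ∑ i, (c i).1 := by
  rcases Nat.eq_zero_or_pos T with rfl | hT
  · exact ⟨fun _ => 0, ⟨P.zero_mem, fun j => by simpa using P.B_pos.le⟩, by simpa using hx⟩
  have hT' : (0 : ℝ) < T := by exact_mod_cast hT
  rw [← div_lt_iff₀' hT'] at hx
  obtain ⟨_, ⟨c, h1, h2, rfl⟩, h⟩ := exists_lt_of_lt_csSup OPT_nonempty hx
  exact ⟨c, ⟨h1, h2⟩, (div_lt_div_iff_of_pos_right hT').1 h⟩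

end Benchmark

/-- Lets additive constants be absorbed into ε²B and ε²·T·OPT, both of which are at least L. -/
lemma half_lt_log_max (d : ℕ) : 1 ≤ 2 * Real.log (max d 2 : ℕ) := by
  have h1 : Real.log 2 ≤ Real.log (max d 2 : ℕ) :=
    Real.log_le_log (by norm_num) (by exact_mod_cast le_max_right d 2)
  have := Real.log_two_gt_d9
  linarith

lemma log_add_two_le (d : ℕ) : Real.log ((d : ℝ) + 2) ≤ 2 * Real.log (max d 2 : ℕ) := by
  have h : ((d : ℝ) + 2) ≤ ((max d 2 : ℕ) : ℝ) ^ 2 := by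
    have h1 : (d : ℝ) ≤ (max d 2 : ℕ) := by exact_mod_cast le_max_left d 2
    have h2 : (2 : ℝ) ≤ (max d 2 : ℕ) := by exact_mod_cast le_max_right d 2
    nlinarith
  have h2 := Real.log_le_log (by positivity) h
  rw [Real.log_pow] at h2
  exact_mod_cast h2

lemma log_add_one_le (d : ℕ) : Real.log ((d : ℝ) + 1) ≤ 2 * Real.log (max d 2 : ℕ) :=
  (Real.log_le_log (by positivity) (by linarith)).trans (log_add_two_le d)

/-! ### Arrival sequences -/

section Arrival

variable {d T : ℕ} {P : Instance d T}

lemma arrival_of_lt (π : Equiv.Perm (Fin T)) {t : ℕ} (h : t < T) :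
    P.arrival π t = P.X (π ⟨t, h⟩) := by
  simp [Instance.arrival, h]

lemma arrival_congr {π π' : Equiv.Perm (Fin T)} {m t : ℕ}
    (h : ∀ k : Fin T, (k : ℕ) < m → π k = π' k) (ht : t < m) :
    P.arrival π t = P.arrival π' t := by
  unfold Instance.arrival
  split_ifs with hT
  · rw [h ⟨t, hT⟩ ht]
  · rfl

lemma zero_mem_arrival (π : Equiv.Perm (Fin T)) (t : ℕ) : (0 : Choice d) ∈ P.arrival π t := by
  unfold Instance.arrival
  split_ifs
  · exact P.zero_mem _
  · rfl

lemma Alg.state_congr {σ : Type} (alg : Alg d σ) {A A' : ℕ → Set (Choice d)} {t : ℕ}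
    (h : ∀ k < t, A k = A' k) : alg.state A t = alg.state A' t := by
  induction t with
  | zero => rfl
  | succ t ih => rw [Alg.state, Alg.state, ih fun k hk => h k (by omega), h t (by omega)]

end Arrival

/-! ### The packing algorithm in the random permutation model -/

section RandomOrder

variable {d T : ℕ} {P : Instance d T} {pick : Set (Choice d) → (Fin d → ℝ) → Choice d} {ε : ℝ}

lemma packingState_dependsOnPrefix {n : ℕ} {Z : Equiv.Perm (Fin T) → ℝ}
    (hZ : DependsOnPrefix n Z) (t : ℕ) :
    DependsOnPrefix (n + t) fun π =>
      packingState pick P.B T ε (Z π) (fun k => P.arrival π (n + k)) t := by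
  intro π π' h
  simp only
  rw [hZ π π' fun k hk => h k (by omega)]
  exact Alg.state_congr _ fun k hk => arrival_congr h (by omega)

lemma sum_div_sqrt_le {n N : ℕ} (hT : 0 < T) (hε : 0 < ε) (hnN : n + N ≤ T) {a : ℝ} (ha : 0 ≤ a) :
    ∑ t ∈ Finset.range N, a / (ε * Real.sqrt T * Real.sqrt ((T - (n + t) : ℕ) : ℝ)) ≤
      2 * a / ε := by
  have hT' : (0 : ℝ) < T := by exact_mod_cast hT
  have hs : 0 < Real.sqrt T := Real.sqrt_pos.2 hT'
  have h1 := sum_inv_sqrt_le T (n + N) hnN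
  rw [Finset.sum_range_add] at h1
  have h2 : 0 ≤ ∑ m ∈ Finset.range n, 1 / Real.sqrt ((T - m : ℕ) : ℝ) :=
    Finset.sum_nonneg fun m _ => by positivity
  have h3 : ∑ t ∈ Finset.range N, 1 / Real.sqrt ((T - (n + t) : ℕ) : ℝ) ≤ 2 * Real.sqrt T := by
    linarith [Real.sqrt_nonneg ((T - (n + N) : ℕ) : ℝ)]
  have e : ∀ t, a / (ε * Real.sqrt T * Real.sqrt ((T - (n + t) : ℕ) : ℝ)) =
      a / (ε * Real.sqrt T) * (1 / Real.sqrt ((T - (n + t) : ℕ) : ℝ)) := by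
    intro t
    rw [div_mul_div_comm, mul_one]
  simp only [e]
  rw [← Finset.mul_sum]
  refine (mul_le_mul_of_nonneg_left h3 (by positivity)).trans (le_of_eq ?_)
  field_simp

open Classical in
/-- Comparison of the packing algorithm, started at time `n` with a parameter that depends on the
past, with a fixed choice of options. -/
lemma permMean_packing_ge_of_comparison (hrule : IsArgmaxRule P pick) (hε : 0 < ε) {n N : ℕ}
    (hT : 0 < T) (hnN : n + N ≤ T) (hlarge : ∀ t < N, ε ^ 2 * T ≤ ((T - (n + t) : ℕ) : ℝ))
    {Z : Equiv.Perm (Fin T) → ℝ} (hZ : DependsOnPrefix n Z)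
    {G : Equiv.Perm (Fin T) → Prop} (hG : DependsOnPrefix n G)
    {c : Fin T → Choice d} (hc : P.IsFeasible c) {Γ : ℝ} (hΓ : 0 ≤ Γ)
    (hZ0 : ∀ π, G π → 0 ≤ Z π) (hZc : ∀ π, G π → ∑ i, (c i).1 ≤ Z π * P.B)
    (hZΓ : ∀ π, G π → Z π ≤ Γ) :
    permProb G * ((∑ i, (c i).1) / T * N) -
        (Γ * ((1 / ε + P.B / T) * Real.log (d + 1) + ε * P.B + 1 + P.B / T) + 1 +
          2 * (2 + ε ^ 2 * ∑ i, (c i).1) / ε +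
          2 * (Γ * (Real.log (d + 1) + 1 + ε ^ 2 * P.B)) / ε) ≤
      permMean (fun π => if G π then ∑ t ∈ Finset.range N,
        ((packingAlg pick P.B T ε (Z π)).played (fun k => P.arrival π (n + k)) t).1 else 0) := by
  set R := ∑ i, (c i).1 with hR
  set b := P.B / T with hb
  set E₀ := (1 / ε + b) * Real.log (d + 1) + ε * P.B + 1 + b with hE₀
  have hB := P.B_pos
  have hT' : (0 : ℝ) < T := by exact_mod_cast hT
  have hb0 : 0 < b := by positivity
  have hlog : 0 ≤ Real.log ((d : ℝ) + 1) :=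
    Real.log_nonneg (by linarith [(Nat.cast_nonneg d : (0 : ℝ) ≤ d)])
  have hE₀0 : 0 ≤ E₀ := by positivity
  have hR0 : 0 ≤ R := Finset.sum_nonneg fun i _ => (P.reward_mem i _ (hc.1 i)).1
  set A : Equiv.Perm (Fin T) → ℕ → Set (Choice d) := fun π k => P.arrival π (n + k) with hA
  set θ : Equiv.Perm (Fin T) → ℕ → Fin d → ℝ :=
    fun π t => (packingState pick P.B T ε (Z π) (A π) t).θ with hθ
  set act : Equiv.Perm (Fin T) → ℕ → ℝ :=
    fun π t => packingActive pick P.B T ε (Z π) (A π) t with hact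
  -- The event is decided by the first n requests, so its indicator can be a factor of the weights
  -- that depend on the past. Outside of it nothing is known about Z.
  set I : Equiv.Perm (Fin T) → ℝ := fun π => if G π then 1 else 0 with hI
  have hI01 : ∀ π, I π = 0 ∨ I π = 1 := fun π => by
    simp only [hI]
    split_ifs <;> simp
  have hact0 : ∀ π t, 0 ≤ act π t := fun π t => packingActive_nonneg _ _ _
  have hact1 : ∀ π t, act π t ≤ 1 := fun π t => packingActive_le_one _ _ _
  have hθ0 : ∀ π t j, 0 ≤ θ π t j := fun π t j => packing_dual_nonneg pick (A π) hε t j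
  have hθ1 : ∀ π t, ∑ j, θ π t j ≤ 1 := fun π t => packing_sum_dual_le pick (A π) hε t
  have hprefI : ∀ t, DependsOnPrefix (n + t) I := fun t π π' h => by
    simp only [hI, hG π π' fun k hk => h k (by omega)]
  have hprefact : ∀ t, DependsOnPrefix (n + t) fun π => act π t := fun t π π' h => by
    simp only [hact, packingActive, hA,
      packingState_dependsOnPrefix (pick := pick) (P := P) (ε := ε) hZ t π π' h]
  have hprefθ : ∀ t j, DependsOnPrefix (n + t) fun π => θ π t j := fun t j π π' h => by
    simp only [hθ, hA, packingState_dependsOnPrefix (pick := pick) (P := P) (ε := ε) hZ t π π' h]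
  set x : ℕ → Equiv.Perm (Fin T) → Choice d :=
    fun t π => if h : n + t < T then c (π ⟨n + t, h⟩) else 0 with hx
  -- pathwise comparison
  have hpath : ∀ π, I π * (R / T * N) - (Γ * E₀ + 1) -
      (∑ t ∈ Finset.range N, I π * act π t * (R / T - (x t π).1)) -
      (∑ t ∈ Finset.range N, ∑ j, I π * act π t * Z π * θ π t j * ((x t π).2 j - b)) ≤
      if G π then ∑ t ∈ Finset.range N,
        ((packingAlg pick P.B T ε (Z π)).played (A π) t).1 else 0 := by
    intro π
    by_cases hGπ : G π
    · have hIπ : I π = 1 := by simp [hI, hGπ]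
      have hZπ := hZ0 π hGπ
      simp only [hIπ, one_mul, if_pos hGπ]
      set ch := packingChoice pick P.B T ε (Z π) (A π) with hch
      have hAt : ∀ t (h : t < N), A π t = P.X (π ⟨n + t, by omega⟩) :=
        fun t h => arrival_of_lt π (by omega)
      have hrule' := fun t (h : t < N) => hrule (π ⟨n + t, by omega⟩)
        (fun j => Z π * θ π t j) (fun j => packing_price_nonneg pick (A π) hε hZπ t j)
      have hmem : ∀ t (h : t < N), ch t ∈ P.X (π ⟨n + t, by omega⟩) := fun t h => by
        have := (hrule' t h).1
        rwa [← hAt t h] at this ⊢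
      have h1 := packing_reward pick (A π) (B := P.B) (T := T) (ε := ε) (Z := Z π) (N := N)
        fun t h => P.reward_mem _ _ (hmem t h)
      have h2 := packing_value pick (A π) hε hB hT hZπ (N := N) (by omega)
        (fun t h j => P.cost_mem _ _ (hmem t h) j) (ρ := R / T) (by positivity)
        (by rw [div_mul_cancel₀ _ hT'.ne']; exact hZc π hGπ)
      have h3 : Z π * E₀ ≤ Γ * E₀ := mul_le_mul_of_nonneg_right (hZΓ π hGπ) hE₀0
      -- Maximality of the chosen option against the comparison option, step by step. The term Zθ·b
      -- is the same for both, so costs may be measured relative to b.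
      have h4 : ∑ t ∈ Finset.range N, act π t * (R / T + Z π * ∑ j, θ π t j * ((ch t).2 j - b)) -
          (∑ t ∈ Finset.range N, act π t * (R / T - (x t π).1)) -
          (∑ t ∈ Finset.range N, ∑ j, act π t * Z π * θ π t j * ((x t π).2 j - b)) ≤
          ∑ t ∈ Finset.range N, act π t * (ch t).1 := by
        rw [← Finset.sum_sub_distrib, ← Finset.sum_sub_distrib]
        refine Finset.sum_le_sum fun t ht => ?_
        have ht' := Finset.mem_range.1 ht
        have hopt := (hrule' t ht').2 (c (π ⟨n + t, by omega⟩)) (hc.1 _)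
        have hxt : x t π = c (π ⟨n + t, by omega⟩) := by
          simp only [hx]
          rw [dif_pos]
        rw [← hxt, ← hAt t ht'] at hopt
        have hsub : ∀ u : Choice d, ∑ j, Z π * θ π t j * u.2 j =
            Z π * ∑ j, θ π t j * (u.2 j - b) + Z π * (∑ j, θ π t j) * b := by
          intro u
          rw [Finset.mul_sum, mul_assoc, Finset.sum_mul, Finset.mul_sum, ← Finset.sum_add_distrib]
          refine Finset.sum_congr rfl fun j _ => ?_
          ring
        rw [hsub, hsub] at hopt
        have e : ∑ j, act π t * Z π * θ π t j * ((x t π).2 j - b) =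
            act π t * (Z π * ∑ j, θ π t j * ((x t π).2 j - b)) := by
          rw [Finset.mul_sum, Finset.mul_sum]
          refine Finset.sum_congr rfl fun j _ => ?_
          ring
        rw [e, ← mul_sub, ← mul_sub]
        refine mul_le_mul_of_nonneg_left ?_ (hact0 π t)
        change _ ≤ (ch t).1 - (Z π * ∑ j, θ π t j * ((ch t).2 j - b) + _) at hopt
        linarith
      linarith
    · have hIπ : I π = 0 := by simp [hI, hGπ]
      simp only [hIπ, zero_mul, if_neg hGπ, Finset.sum_const_zero]
      have : 0 ≤ Γ * E₀ := mul_nonneg hΓ hE₀0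
      linarith
  refine le_trans ?_ (permMean_mono hpath)
  rw [permMean_sub, permMean_sub, permMean_sub, permMean_const, permMean_sum, permMean_sum]
  have hPG : permMean (fun π => I π * (R / T * N)) = permProb G * (R / T * N) := by
    rw [permProb_eq_permMean, mul_comm (permMean _), ← permMean_const_mul]
    congr 1
    ext π
    exact mul_comm _ _
  rw [hPG]
  have hrew : ∑ t ∈ Finset.range N, permMean (fun π => I π * act π t * (R / T - (x t π).1)) ≤
      2 * (2 + ε ^ 2 * R) / ε := by
    refine (Finset.sum_le_sum fun t ht => ?_).trans
      (sum_div_sqrt_le (T := T) (n := n) (N := N) hT hε hnN (by positivity))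
    have ht' := Finset.mem_range.1 ht
    have hnt : n + t < T := by omega
    have := permMean_mul_mean_sub_reward_le (m := ⟨n + t, hnt⟩) (ε := ε)
      (g := fun π => I π * act π t)
      (fun π π' h => by
        have h1 := hprefI t π π' h
        have h2 := hprefact t π π' h
        simp only at h2
        simp only [h1, h2])
      (fun π => by rcases hI01 π with h | h <;> simp [h, hact0])
      (fun π => by rcases hI01 π with h | h <;> simp [h, hact1])
      (r := fun i => (c i).1) (fun i => P.reward_mem i _ (hc.1 i)) hε (hlarge t ht')
    have hxt : ∀ π, x t π = c (π ⟨n + t, hnt⟩) := fun π => by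
      simp only [hx]
      rw [dif_pos]
    simpa only [hxt] using this
  have hcost : ∑ t ∈ Finset.range N, permMean (fun π =>
      ∑ j, I π * act π t * Z π * θ π t j * ((x t π).2 j - b)) ≤
      2 * (Γ * (Real.log (d + 1) + 1 + ε ^ 2 * P.B)) / ε := by
    refine (Finset.sum_le_sum fun t ht => ?_).trans
      (sum_div_sqrt_le (T := T) (n := n) (N := N) hT hε hnN (by positivity))
    have ht' := Finset.mem_range.1 ht
    have hnt : n + t < T := by omega
    -- The weights are the prices Zθ, switched off after the exit and outside the event; they add up
    -- to at most Γ.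
    have := permMean_price_mul_cost_le (m := ⟨n + t, hnt⟩) (ε := ε)
      (g := fun j π => I π * act π t * Z π * θ π t j)
      (fun j π π' h => by
        have h1 := hprefI t π π' h
        have h2 := hprefact t π π' h
        have h3 := hprefθ t j π π' h
        have h4 := hZ π π' fun k hk => h k (by simp; omega)
        simp only at h2 h3
        simp only [h1, h2, h3, h4])
      (fun j π => by
        by_cases hGπ : G π
        · have := hZ0 π hGπ
          have := hθ0 π t j
          have := hact0 π t
          simp only [hI, if_pos hGπ]
          positivity
        · simp [hI, hGπ])
      (G := Γ) (fun π => by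
        by_cases hGπ : G π
        · have h0 := hZ0 π hGπ
          have h1 := hZΓ π hGπ
          simp only [hI, if_pos hGπ, one_mul]
          rw [← Finset.mul_sum]
          calc act π t * Z π * ∑ j, θ π t j ≤ act π t * Z π * 1 :=
                mul_le_mul_of_nonneg_left (hθ1 π t) (mul_nonneg (hact0 π t) h0)
            _ ≤ 1 * Γ := by
                rw [mul_one]
                exact mul_le_mul (hact1 π t) h1 h0 zero_le_one
            _ = Γ := one_mul _
        · simpa [hI, hGπ] using hΓ)
      (x := fun j i => (c i).2 j) (fun j i => P.cost_mem i _ (hc.1 i) j) hB.le hc.2 hε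
      (hlarge t ht')
    have hxt : ∀ π, x t π = c (π ⟨n + t, hnt⟩) := fun π => by
      simp only [hx]
      rw [dif_pos]
    simpa only [hxt] using this
  linarith

set_option maxHeartbeats 800000 in
open Classical in
/-- The packing algorithm, started at time `n` with a parameter that depends on the past and is
admissible in the event `G`. -/
lemma permMean_packing_ge (hrule : IsArgmaxRule P pick) (hε : 0 < ε) (hε1 : ε ≤ 1)
    (hL : Real.log (max d 2 : ℕ) / ε ^ 2 ≤ min P.B (T * P.OPT)) {n : ℕ} (hn : n ≤ T)
    {Z : Equiv.Perm (Fin T) → ℝ} (hZ : DependsOnPrefix n Z)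
    {G : Equiv.Perm (Fin T) → Prop} (hG : DependsOnPrefix n G) {K : ℝ} (hK : 1 ≤ K)
    (hZ1 : ∀ π, G π → T * P.OPT / P.B ≤ Z π) (hZ2 : ∀ π, G π → Z π ≤ K * (T * P.OPT / P.B)) :
    permProb G * (T * P.OPT) - n * P.OPT - 36 * K * ε * (T * P.OPT) ≤
      permMean (fun π => if G π then ∑ t ∈ Finset.range (T - n),
        ((packingAlg pick P.B T ε (Z π)).played (fun k => P.arrival π (n + k)) t).1 else 0) := by
  have hB := P.B_pos
  obtain ⟨hLB, hLM⟩ := le_min_iff.1 hL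
  rw [div_le_iff₀ (by positivity)] at hLB hLM
  have hL1 := half_lt_log_max d
  set L := Real.log (max d 2 : ℕ) with hLdef
  have hlog0 : 0 ≤ Real.log ((d : ℝ) + 1) :=
    Real.log_nonneg (by linarith [(Nat.cast_nonneg d : (0 : ℝ) ≤ d)])
  have hlog := log_add_one_le d
  rw [← hLdef] at hlog
  set M := T * P.OPT with hM
  have hMT : M ≤ T := mul_OPT_le
  have hM0 : 0 < M := by nlinarith [pow_pos hε 2]
  have hT' : (0 : ℝ) < T := hM0.trans_le hMT
  have hT : 0 < T := by exact_mod_cast hT'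
  obtain ⟨c, hc, hcR⟩ := exists_feasible_of_lt_OPT (P := P) (x := M - 1) (by linarith)
  have hRM := sum_reward_le_OPT hc
  rw [← hM] at hRM
  set R := ∑ i, (c i).1 with hR
  have hR0 : 0 ≤ R := Finset.sum_nonneg fun i _ => (P.reward_mem i _ (hc.1 i)).1
  set Γ := K * (M / P.B) with hΓ
  have hΓ0 : 0 ≤ Γ := by positivity
  have hΓB : Γ * P.B = K * M := by
    rw [hΓ]
    field_simp
  -- The last ⌈ε²T⌉ requests are left out, where too few remain for the sampling bounds; dropping
  -- them is harmless because rewards are nonnegative.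
  set N := T - ⌈ε ^ 2 * T⌉₊ - n with hN
  have hceil := Nat.le_ceil (ε ^ 2 * T)
  have hceil' := Nat.ceil_lt_add_one (a := ε ^ 2 * T) (by positivity)
  have hNreal : (T : ℝ) - (ε ^ 2 * T + 1) - n ≤ N := by
    have h : T ≤ N + ⌈ε ^ 2 * T⌉₊ + n := by omega
    have h' : (T : ℝ) ≤ N + ⌈ε ^ 2 * T⌉₊ + n := by exact_mod_cast h
    linarith
  have hlarge : ∀ t < N, ε ^ 2 * T ≤ ((T - (n + t) : ℕ) : ℝ) := fun t ht =>
    hceil.trans (by exact_mod_cast (by omega : ⌈ε ^ 2 * T⌉₊ ≤ T - (n + t)))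
  have hZc : ∀ π, G π → R ≤ Z π * P.B := fun π h =>
    hRM.trans ((div_le_iff₀ hB).1 (hZ1 π h))
  have hZ0 : ∀ π, G π → 0 ≤ Z π := fun π h => le_trans (by positivity) (hZ1 π h)
  have key := permMean_packing_ge_of_comparison hrule hε hT (by omega : n + N ≤ T) hlarge hZ hG hc
    hΓ0 hZ0 hZc hZ2
  rw [← hR] at key
  have hplayed : ∀ π, G π → ∀ t < T - n, 0 ≤
      ((packingAlg pick P.B T ε (Z π)).played (fun k => P.arrival π (n + k)) t).1 := by
    intro π h t ht
    have hA := arrival_of_lt (P := P) π (t := n + t) (by omega)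
    have := packing_played_mem pick (fun k => P.arrival π (n + k)) (B := P.B) (T := T) hε
      (hZ0 π h) t (zero_mem_arrival π _) (fun p hp => by
        simp only [hA]
        exact (hrule _ p hp).1)
    simp only [hA] at this
    exact (P.reward_mem _ _ this).1
  have hmono : permMean (fun π => if G π then ∑ t ∈ Finset.range N,
        ((packingAlg pick P.B T ε (Z π)).played (fun k => P.arrival π (n + k)) t).1 else 0) ≤
      permMean (fun π => if G π then ∑ t ∈ Finset.range (T - n),
        ((packingAlg pick P.B T ε (Z π)).played (fun k => P.arrival π (n + k)) t).1 else 0) := by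
    refine permMean_mono fun π => ?_
    split_ifs with h
    · exact Finset.sum_le_sum_of_subset_of_nonneg (Finset.range_subset_range.2 (by omega))
        fun t ht _ => hplayed π h t (Finset.mem_range.1 ht)
    · exact le_rfl
  refine le_trans ?_ (key.trans hmono)
  have hε2 : ε ^ 2 ≤ ε := by nlinarith
  have h1B : 1 ≤ 2 * (ε ^ 2 * P.B) := by linarith
  have h1M : 1 ≤ 2 * (ε ^ 2 * M) := by linarith
  have hεM : ε ^ 2 * M ≤ ε * M := mul_le_mul_of_nonneg_right hε2 hM0.le
  have hεB : ε ^ 2 * P.B ≤ ε * P.B := mul_le_mul_of_nonneg_right hε2 hB.le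
  have hb : P.B / T ≤ 2 * (ε ^ 2 * P.B) := by
    rw [div_le_iff₀ hT']
    have h1 := mul_le_mul_of_nonneg_left (h1M.trans (b := 2 * (ε ^ 2 * M))
      (c := 2 * (ε ^ 2 * T)) (by linarith [mul_le_mul_of_nonneg_left hMT (sq_nonneg ε)])) hB.le
    linarith
  have hblog : P.B / T * Real.log (d + 1) ≤ 2 * (ε ^ 2 * P.B) := by
    rw [div_mul_eq_mul_div, div_le_iff₀ hT']
    have h1 : Real.log ((d : ℝ) + 1) ≤ 2 * (T * ε ^ 2) := by
      linarith [mul_le_mul_of_nonneg_right hMT (by positivity : 0 ≤ ε ^ 2)]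
    have h2 := mul_le_mul_of_nonneg_left h1 hB.le
    linarith
  have hεlog : 1 / ε * Real.log (d + 1) ≤ 2 * (ε * P.B) := by
    rw [div_mul_eq_mul_div, div_le_iff₀ hε]
    have h1 : 2 * (ε * P.B) * ε = 2 * (ε ^ 2 * P.B) := by ring
    linarith
  have hE : Γ * ((1 / ε + P.B / T) * Real.log (d + 1) + ε * P.B + 1 + P.B / T) ≤
      9 * K * ε * M := by
    have h1 : (1 / ε + P.B / T) * Real.log (d + 1) + ε * P.B + 1 + P.B / T ≤ 9 * (ε * P.B) := by
      rw [add_mul]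
      linarith
    refine (mul_le_mul_of_nonneg_left h1 hΓ0).trans (le_of_eq ?_)
    linear_combination 9 * ε * hΓB
  have hrew : 2 * (2 + ε ^ 2 * R) / ε ≤ 10 * ε * M := by
    rw [div_le_iff₀ hε]
    have h1 := mul_le_mul_of_nonneg_left hRM (by positivity : 0 ≤ ε ^ 2)
    have h2 : 10 * ε * M * ε = 10 * (ε ^ 2 * M) := by ring
    linarith
  have hcost : 2 * (Γ * (Real.log (d + 1) + 1 + ε ^ 2 * P.B)) / ε ≤ 10 * K * ε * M := by
    rw [div_le_iff₀ hε]
    have h1 : Real.log ((d : ℝ) + 1) + 1 + ε ^ 2 * P.B ≤ 5 * (ε ^ 2 * P.B) := by linarith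
    have h2 := mul_le_mul_of_nonneg_left h1 hΓ0
    have h3 : Γ * (5 * (ε ^ 2 * P.B)) = 5 * ε ^ 2 * (K * M) := by rw [← hΓB]; ring
    have h4 : 10 * K * ε * M * ε = 2 * (5 * ε ^ 2 * (K * M)) := by ring
    linarith
  have hρN : M - 5 * (ε * M) - n * P.OPT ≤ R / T * N := by
    have h1 : R / T * ((T : ℝ) - (ε ^ 2 * T + 1) - n) ≤ R / T * N :=
      mul_le_mul_of_nonneg_left hNreal (by positivity)
    have h2 : R / T * ((T : ℝ) - (ε ^ 2 * T + 1) - n) = R - ε ^ 2 * R - R / T - R / T * n := by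
      field_simp
      ring
    have h3 : R / T ≤ P.OPT := by
      rw [div_le_iff₀ hT']
      linarith
    have h4 : R / T * n ≤ P.OPT * n := mul_le_mul_of_nonneg_right h3 (Nat.cast_nonneg n)
    have h5 := OPT_le_one (P := P)
    have h6 : ε ^ 2 * R ≤ ε ^ 2 * M := mul_le_mul_of_nonneg_left hRM (by positivity)
    linarith
  have hPG0 := permProb_nonneg G
  have hPG1 := permProb_le_one G
  have hPG : permProb G * M - 5 * (ε * M) - n * P.OPT ≤ permProb G * (R / T * N) := by
    have h1 := mul_le_mul_of_nonneg_left hρN hPG0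
    have h2 : 0 ≤ 5 * (ε * M) + n * P.OPT :=
      add_nonneg (by positivity) (mul_nonneg (Nat.cast_nonneg n) OPT_nonneg)
    have h3 := mul_le_mul_of_nonneg_right hPG1 h2
    have h4 : permProb G * (M - 5 * (ε * M) - n * P.OPT) =
      permProb G * M - permProb G * (5 * (ε * M) + n * P.OPT) := by ring
    linarith
  -- In units of εM, `hE` and `hcost` lose 9K + 10K, and `hrew`, `hPG` and the discarded option lose
  -- 10 + 5 + 2. The sum is at most 36K as K ≥ 1.
  have hK' : ε * M ≤ K * (ε * M) := le_mul_of_one_le_left (by positivity) hK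
  have e1 : K * ε * M = K * (ε * M) := by ring
  linarith

end RandomOrder


/-! ### Independent rounding of mixtures of choices -/

section Rounding

variable {ι κ : Type*} [Fintype ι] [DecidableEq ι] [Fintype κ]

/-- Exponential moment of a sum of independent `[0,1]`-valued terms. -/
lemma sum_prod_mul_exp_le {ω : κ → ℝ} (hω : ∀ k, 0 ≤ ω k) (hω1 : ∑ k, ω k = 1)
    {x : ι → κ → ℝ} (hx : ∀ i k, x i k ∈ Set.Icc (0 : ℝ) 1) (l : ℝ) :
    ∑ f : ι → κ, (∏ i, ω (f i)) * Real.exp (l * ∑ i, x i (f i)) ≤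
      Real.exp ((∑ i, ∑ k, ω k * x i k) * (Real.exp l - 1)) := by
  have e : ∑ f : ι → κ, (∏ i, ω (f i)) * Real.exp (l * ∑ i, x i (f i)) =
      ∏ i, ∑ k, ω k * Real.exp (l * x i k) := by
    rw [Finset.prod_univ_sum, Fintype.piFinset_univ]
    refine Finset.sum_congr rfl fun f _ => ?_
    rw [Finset.mul_sum, Real.exp_sum, Finset.prod_mul_distrib]
  rw [e, Finset.sum_mul, Real.exp_sum]
  refine Finset.prod_le_prod (fun i _ => Finset.sum_nonneg fun k _ =>
    mul_nonneg (hω k) (Real.exp_pos _).le) fun i _ => ?_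
  refine le_trans ?_ (Real.add_one_le_exp _)
  calc ∑ k, ω k * Real.exp (l * x i k)
      ≤ ∑ k, ω k * (1 + x i k * (Real.exp l - 1)) :=
        Finset.sum_le_sum fun k _ => mul_le_mul_of_nonneg_left
          (exp_mul_le_of_mem_Icc (hx i k) l) (hω k)
    _ = (∑ k, ω k * x i k) * (Real.exp l - 1) + ∑ k, ω k := by
        rw [Finset.sum_mul, ← Finset.sum_add_distrib]
        refine Finset.sum_congr rfl fun k _ => ?_
        ring
    _ = _ := by rw [hω1]

/-- The product weights form a probability distribution, so a mean below 1 forces some value below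
1. -/
lemma exists_lt_one_of_sum_prod_mul_lt {ω : κ → ℝ} (hω : ∀ k, 0 ≤ ω k) (hω1 : ∑ k, ω k = 1)
    {F : (ι → κ) → ℝ} (h : ∑ f : ι → κ, (∏ i, ω (f i)) * F f < 1) : ∃ f, F f < 1 := by
  by_contra! hF
  have h1 : ∑ f : ι → κ, ∏ i, ω (f i) = 1 := by
    have := Finset.prod_univ_sum (fun _ : ι => (Finset.univ : Finset κ)) fun _ k => ω k
    rw [Fintype.piFinset_univ] at this
    rw [← this]
    simp [hω1]
  have h2 : ∑ f : ι → κ, ∏ i, ω (f i) ≤ ∑ f : ι → κ, (∏ i, ω (f i)) * F f :=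
    Finset.sum_le_sum fun f _ =>
      le_mul_of_one_le_right (Finset.prod_nonneg fun i _ => hω _) (hF f)
  linarith

end Rounding

/-! ### Integrality gap and dual prices -/

section Duality

variable {d T : ℕ} {P : Instance d T} {ε : ℝ}

/-- Total rewards and costs of all choices of one option per request. -/
def Instance.totals (P : Instance d T) : Set (Choice d) :=
  {z | ∃ c : Fin T → Choice d, (∀ i, c i ∈ P.X i) ∧ z = ∑ i, c i}

lemma zero_mem_totals : (0 : Choice d) ∈ P.totals := ⟨fun _ => 0, P.zero_mem, by simp⟩

lemma exp_neg_mul_le_quarter {L : ℝ} (hL : 1 ≤ 2 * L) {a : ℝ} (ha : 6 * L ≤ a) :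
    Real.exp (-a) < 1 / 4 := by
  have h1 : Real.exp (-a) ≤ Real.exp (-3) := Real.exp_le_exp.2 (by linarith)
  have h2 : Real.exp (-3) < 1 / 4 := by
    rw [Real.exp_neg, inv_lt_comm₀ (Real.exp_pos _) (by norm_num)]
    have := Real.add_one_lt_exp (x := 3) (by norm_num)
    norm_num at this ⊢
    linarith
  linarith

/-- A mixture of choices that keeps clear of the budget has hardly more reward than the best
single choice. -/
lemma reward_le_of_mem_convexHull (hε : 0 < ε) (hε0 : ε ≤ 1 / 100)
    (hL : Real.log (max d 2 : ℕ) / ε ^ 2 ≤ min P.B (T * P.OPT)) {z : Choice d}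
    (hz : z ∈ convexHull ℝ P.totals) (hzB : ∀ j, z.2 j ≤ 19 / 20 * P.B) :
    z.1 ≤ 20 / 19 * (T * P.OPT) := by
  have hB := P.B_pos
  obtain ⟨hLB, hLM⟩ := le_min_iff.1 hL
  have hL1 := half_lt_log_max d
  set L := Real.log (max d 2 : ℕ) with hLdef
  set M := T * P.OPT with hM
  have hbig : 10000 * L ≤ L / ε ^ 2 := by
    rw [le_div_iff₀ (by positivity)]
    have : ε ^ 2 ≤ (1 / 100) ^ 2 := pow_le_pow_left₀ hε.le hε0 2
    nlinarith
  -- The contrary assumption makes z.1 a large multiple of L, which the Chernoff bound for the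
  -- reward needs.
  by_contra! hR
  rw [mem_convexHull_iff_exists_fintype] at hz
  obtain ⟨κ, _, ω, y, hω, hω1, hy, hyz⟩ := hz
  -- Randomized rounding: each request independently follows the k-th choice with probability ω k.
  choose c hcX hcy using hy
  have hz1 : z.1 = ∑ i, ∑ k, ω k * (c k i).1 := by
    rw [← hyz, Finset.sum_comm, Prod.fst_sum]
    refine Finset.sum_congr rfl fun k _ => ?_
    rw [hcy k, Prod.smul_fst, Prod.fst_sum, smul_eq_mul, Finset.mul_sum]
  have hz2 : ∀ j, z.2 j = ∑ i, ∑ k, ω k * (c k i).2 j := by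
    intro j
    rw [← hyz, Finset.sum_comm, Prod.snd_sum, Finset.sum_apply]
    refine Finset.sum_congr rfl fun k _ => ?_
    rw [hcy k, Prod.smul_snd, Pi.smul_apply, Prod.snd_sum, Finset.sum_apply, smul_eq_mul,
      Finset.mul_sum]
  have hcost : ∀ j, ∑ f : Fin T → κ, (∏ i, ω (f i)) *
      Real.exp (3 / 100 * (∑ i, (c (f i) i).2 j - P.B)) ≤ Real.exp (-(7 * L)) / d := by
    intro j
    have hd : (0 : ℝ) < d := by exact_mod_cast j.pos
    have h := sum_prod_mul_exp_le (ι := Fin T) hω hω1 (x := fun i k => (c k i).2 j)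
      (fun i k => P.cost_mem i _ (hcX k i) j) (3 / 100)
    rw [← hz2 j] at h
    have e : ∀ f : Fin T → κ, (∏ i, ω (f i)) *
        Real.exp (3 / 100 * (∑ i, (c (f i) i).2 j - P.B)) =
        (∏ i, ω (f i)) * Real.exp (3 / 100 * ∑ i, (c (f i) i).2 j) *
          Real.exp (-(3 / 100 * P.B)) := by
      intro f
      rw [mul_assoc, ← Real.exp_add]
      congr 2
      ring
    simp only [e]
    rw [← Finset.sum_mul, le_div_iff₀ hd]
    -- The factor d is for the union over coordinates; it is paid for by one unit of L in the
    -- exponent.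
    have hdL : (d : ℝ) ≤ Real.exp L := by
      rw [hLdef, Real.exp_log (by positivity)]
      exact_mod_cast le_max_left d 2
    have h1 := exp_sub_one_le_of_abs_le_one (l := 3 / 100) (by rw [abs_of_pos] <;> norm_num)
    have h0 := Real.add_one_le_exp (3 / 100 : ℝ)
    calc (∑ f : Fin T → κ, (∏ i, ω (f i)) * Real.exp (3 / 100 * ∑ i, (c (f i) i).2 j)) *
          Real.exp (-(3 / 100 * P.B)) * d
        ≤ Real.exp (z.2 j * (Real.exp (3 / 100) - 1)) * Real.exp (-(3 / 100 * P.B)) *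
          Real.exp L := by gcongr
      _ ≤ Real.exp (-(7 * L)) := by
          rw [← Real.exp_add, ← Real.exp_add, Real.exp_le_exp]
          have h2 : z.2 j * (Real.exp (3 / 100) - 1) ≤
              19 / 20 * P.B * (3 / 100 + 3 / 4 * (3 / 100) ^ 2) :=
            mul_le_mul (hzB j) h1 (by linarith) (by positivity)
          linarith
  have hrew : ∑ f : Fin T → κ, (∏ i, ω (f i)) *
      Real.exp (1 / 20 * (19 / 20 * z.1 - ∑ i, (c (f i) i).1)) ≤ Real.exp (-(12 * L)) := by
    have h := sum_prod_mul_exp_le (ι := Fin T) hω hω1 (x := fun i k => (c k i).1)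
      (fun i k => P.reward_mem i _ (hcX k i)) (-(1 / 20))
    rw [← hz1] at h
    have e : ∀ f : Fin T → κ, (∏ i, ω (f i)) *
        Real.exp (1 / 20 * (19 / 20 * z.1 - ∑ i, (c (f i) i).1)) =
        (∏ i, ω (f i)) * Real.exp (-(1 / 20) * ∑ i, (c (f i) i).1) *
          Real.exp (1 / 20 * (19 / 20 * z.1)) := by
      intro f
      rw [mul_assoc, ← Real.exp_add]
      congr 2
      ring
    simp only [e]
    rw [← Finset.sum_mul]
    refine (mul_le_mul_of_nonneg_right h (Real.exp_pos _).le).trans ?_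
    rw [← Real.exp_add, Real.exp_le_exp]
    have h1 := exp_neg_le_quadratic (x := 1 / 20) (by norm_num)
    have h3 : 0 ≤ z.1 := by linarith
    have h2 : z.1 * (Real.exp (-(1 / 20)) - 1) ≤ z.1 * (-(1 / 20) + (1 / 20) ^ 2 / 2) :=
      mul_le_mul_of_nonneg_left (by linarith) h3
    linarith
  -- A sum of exponentials below 1 has only negative exponents: one rounded choice respects all
  -- budgets and earns more than 19/20 of z.1.
  obtain ⟨f, hf⟩ := exists_lt_one_of_sum_prod_mul_lt (ι := Fin T) hω hω1
    (F := fun f => (∑ j, Real.exp (3 / 100 * (∑ i, (c (f i) i).2 j - P.B))) +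
      Real.exp (1 / 20 * (19 / 20 * z.1 - ∑ i, (c (f i) i).1))) (by
      simp only [mul_add, Finset.sum_add_distrib, Finset.mul_sum]
      rw [Finset.sum_comm]
      have h1 : ∑ j, ∑ f : Fin T → κ, (∏ i, ω (f i)) *
          Real.exp (3 / 100 * (∑ i, (c (f i) i).2 j - P.B)) ≤ Real.exp (-(7 * L)) := by
        refine (Finset.sum_le_sum fun j _ => hcost j).trans ?_
        rw [Finset.sum_const, Finset.card_univ, Fintype.card_fin, nsmul_eq_mul]
        rcases eq_or_ne (d : ℝ) 0 with hd | hd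
        · rw [hd, zero_mul]
          exact (Real.exp_pos _).le
        · rw [mul_div_cancel₀ _ hd]
      have h2 := exp_neg_mul_le_quarter hL1 (a := 7 * L) (by linarith)
      have h3 := exp_neg_mul_le_quarter hL1 (a := 12 * L) (by linarith)
      linarith)
  have hf0 : ∀ j, 0 ≤ Real.exp (3 / 100 * (∑ i, (c (f i) i).2 j - P.B)) :=
    fun j => (Real.exp_pos _).le
  have hfeas : P.IsFeasible fun i => c (f i) i := by
    refine ⟨fun i => hcX _ i, fun j => ?_⟩
    have h1 := Finset.single_le_sum (fun j _ => hf0 j) (Finset.mem_univ j)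
    have h2 : Real.exp (3 / 100 * (∑ i, (c (f i) i).2 j - P.B)) < 1 := by
      have := Real.exp_pos (1 / 20 * (19 / 20 * z.1 - ∑ i, (c (f i) i).1))
      linarith
    rw [Real.exp_lt_one_iff] at h2
    linarith
  have h3 : Real.exp (1 / 20 * (19 / 20 * z.1 - ∑ i, (c (f i) i).1)) < 1 := by
    have := Finset.sum_nonneg fun j (_ : j ∈ Finset.univ) => hf0 j
    linarith
  rw [Real.exp_lt_one_iff] at h3
  have := sum_reward_le_OPT hfeas
  linarith

/-! ### Dual prices -/

/-- Letting δ tend to 0 carries a strict inequality on an open set to its boundary. -/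
lemma le_of_forall_pos_add_mul_lt {a u k : ℝ} (h : ∀ δ > 0, a + δ * k < u) : a ≤ u := by
  by_contra! hau
  have hk : 0 < |k| + 1 := by positivity
  have h1 := h ((a - u) / (|k| + 1)) (div_pos (by linarith) hk)
  have h2 : (a - u) / (|k| + 1) * (-k) ≤ (a - u) / (|k| + 1) * (|k| + 1) :=
    mul_le_mul_of_nonneg_left (by linarith [neg_abs_le k, neg_le_abs k])
      (div_nonneg (by linarith) hk.le)
  rw [div_mul_cancel₀ _ hk.ne'] at h2
  linarith

/-- An affine function bounded above on a half-line has nonpositive slope; this gives the signs of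
the multipliers. -/
lemma nonpos_of_forall_add_mul_lt {a u k : ℝ} (h : ∀ s ≥ 0, a + s * k < u) : k ≤ 0 := by
  by_contra! hk
  have h0 := h 0 le_rfl
  have h1 := h ((u - a) / k) (div_nonneg (by linarith) hk.le)
  rw [div_mul_cancel₀ _ hk.ne'] at h1
  linarith

/-- Lagrange multipliers for maximization over a convex set with budget constraints. -/
lemma exists_prices_of_convex {A : Set (Choice d)} (hA : Convex ℝ A) (h0 : (0 : Choice d) ∈ A)
    {b m : ℝ} (hb : 0 < b) (hm : ∀ z ∈ A, (∀ j, z.2 j ≤ b) → z.1 ≤ m) :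
    ∃ p : Fin d → ℝ, (∀ j, 0 ≤ p j) ∧ ∀ z ∈ A, z.1 + (∑ j, p j) * b ≤ m + ∑ j, p j * z.2 j := by
  -- The outcomes better than m and strictly within the budget form an open convex set disjoint from
  -- A, to be separated from A.
  set Q : Set (Choice d) := {z | m < z.1 ∧ ∀ j, z.2 j < b} with hQ
  have hQo : IsOpen Q := by
    have e : Q = {z | m < z.1} ∩ ⋂ j, {z : Choice d | z.2 j < b} := by
      ext z
      simp [hQ]
    rw [e]
    refine (isOpen_lt continuous_const continuous_fst).inter
      (isOpen_iInter_of_finite fun j => isOpen_lt (by fun_prop) continuous_const)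
  have hQc : Convex ℝ Q := by
    rintro x ⟨hx1, hx2⟩ y ⟨hy1, hy2⟩ s t hs ht hst
    refine ⟨?_, fun j => ?_⟩
    · simp only [Prod.fst_add, Prod.smul_fst, smul_eq_mul]
      have : m = s * m + t * m := by rw [← add_mul, hst, one_mul]
      rcases hs.eq_or_lt with rfl | hs'
      · have : t = 1 := by linarith
        subst this
        linarith
      · nlinarith [mul_lt_mul_of_pos_left hx1 hs', mul_le_mul_of_nonneg_left hy1.le ht]
    · simp only [Prod.snd_add, Prod.smul_snd, Pi.add_apply, Pi.smul_apply, smul_eq_mul]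
      have : b = s * b + t * b := by rw [← add_mul, hst, one_mul]
      rcases hs.eq_or_lt with rfl | hs'
      · have : t = 1 := by linarith
        subst this
        linarith [hy2 j]
      · nlinarith [mul_lt_mul_of_pos_left (hx2 j) hs', mul_le_mul_of_nonneg_left (hy2 j).le ht]
  have hdisj : Disjoint Q A := Set.disjoint_left.2 fun z hz hzA =>
    (hm z hzA fun j => (hz.2 j).le).not_gt hz.1
  obtain ⟨f, u, hfQ, hfA⟩ := geometric_hahn_banach_open hQc hQo hA hdisj
  set α := f (1, 0) with hα
  set β : Fin d → ℝ := fun j => f (0, Pi.single j 1) with hβ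
  have hf : ∀ z : Choice d, f z = α * z.1 + ∑ j, β j * z.2 j := by
    intro z
    have e : z = z.1 • ((1, 0) : Choice d) + ∑ j, z.2 j • ((0, Pi.single j 1) : Choice d) := by
      ext j
      · simp [Prod.fst_sum]
      · simp [Prod.snd_sum, Finset.sum_apply, Pi.single_apply]
    conv_lhs => rw [e]
    simp only [map_add, map_smul, map_sum, smul_eq_mul]
    rw [mul_comm]
    congr 1
    exact Finset.sum_congr rfl fun j _ => mul_comm _ _
  simp only [hf] at hfQ hfA
  have hα0 : α ≤ 0 := nonpos_of_forall_add_mul_lt (a := α * (m + 1) + ∑ j, β j * (b - 1)) (u := u)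
    fun s hs => by
      have := hfQ (m + 1 + s, fun _ => b - 1) ⟨by simp only; linarith, fun j => by simp⟩
      simp only at this
      linarith
  have hβ0 : ∀ j, 0 ≤ β j := fun j => by
    have := nonpos_of_forall_add_mul_lt (a := α * (m + 1) + ∑ j, β j * (b - 1)) (u := u)
      (k := -β j) fun s hs => by
        have := hfQ (m + 1, fun i => b - 1 - s * if i = j then 1 else 0)
          ⟨by simp, fun i => by
            have : 0 ≤ s * if i = j then (1 : ℝ) else 0 := by split_ifs <;> simp [hs]
            simp only
            linarith⟩
        have e : ∑ i, β i * (b - 1 - s * if i = j then 1 else 0) =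
            ∑ i, β i * (b - 1) - s * β j := by
          have e' : ∀ i, β i * (b - 1 - s * if i = j then 1 else 0) =
              β i * (b - 1) - if i = j then s * β j else 0 := fun i => by
            split_ifs with h
            · rw [h]
              ring
            · ring
          simp only [e', Finset.sum_sub_distrib, Finset.sum_ite_eq', Finset.mem_univ, if_true]
        simp only [e] at this
        linarith
    linarith
  have hclosure : α * m + (∑ j, β j) * b ≤ u :=
    le_of_forall_pos_add_mul_lt (k := α - ∑ j, β j) fun δ hδ => by
      have := hfQ (m + δ, fun _ => b - δ) ⟨by simp [hδ], fun j => by simp [hδ]⟩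
      simp only [← Finset.sum_mul] at this
      linarith
  have hu : u ≤ 0 := by simpa using hfA 0 h0
  -- Slater's condition: 0 ∈ A and b > 0. If the coefficient of the reward vanished, so would all
  -- others, against strict separation.
  have hαneg : α < 0 := by
    refine lt_of_le_of_ne hα0 fun hα00 => ?_
    rw [hα00, zero_mul, zero_add] at hclosure
    have hsum : ∑ j, β j ≤ 0 := by
      by_contra! h
      have := mul_pos h hb
      linarith
    have hβz : ∀ j, β j = 0 := fun j => le_antisymm
      ((Finset.single_le_sum (fun i _ => hβ0 i) (Finset.mem_univ j)).trans hsum) (hβ0 j)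
    have := hfQ (m + 1, fun _ => b - 1) ⟨by simp, fun j => by simp⟩
    simp only [hα00, hβz, zero_mul, Finset.sum_const_zero, add_zero] at this
    linarith
  refine ⟨fun j => β j / (-α), fun j => div_nonneg (hβ0 j) (by linarith), fun z hz => ?_⟩
  have h1 := hfA z hz
  have h2 : ∑ j, β j / (-α) * z.2 j = (∑ j, β j * z.2 j) / (-α) := by
    rw [Finset.sum_div]
    exact Finset.sum_congr rfl fun j _ => by ring
  rw [h2, ← Finset.sum_div]
  have hα' : 0 < -α := by linarith
  have h3 : (z.1 + (∑ j, β j) / (-α) * b) * (-α) ≤ (m + (∑ j, β j * z.2 j) / (-α)) * (-α) := by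
    have e1 : (z.1 + (∑ j, β j) / (-α) * b) * (-α) = z.1 * (-α) + (∑ j, β j) * b := by
      rw [add_mul, div_mul_eq_mul_div, div_mul_cancel₀ _ hα'.ne']
    have e2 : (m + (∑ j, β j * z.2 j) / (-α)) * (-α) = m * (-α) + ∑ j, β j * z.2 j := by
      rw [add_mul, div_mul_cancel₀ _ hα'.ne']
    rw [e1, e2]
    linarith
  exact le_of_mul_le_mul_right h3 hα'

/-- Near-optimal solution of the dual of the packing LP: prices `p` and values `h`. -/
lemma exists_dual_solution (hε : 0 < ε) (hε0 : ε ≤ 1 / 100)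
    (hL : Real.log (max d 2 : ℕ) / ε ^ 2 ≤ min P.B (T * P.OPT)) :
    ∃ (p : Fin d → ℝ) (h : Fin T → ℝ), (∀ j, 0 ≤ p j) ∧ (∀ i, h i ∈ Set.Icc (0 : ℝ) 1) ∧
      (∀ i, ∀ a ∈ P.X i, a.1 ≤ h i + ∑ j, p j * a.2 j) ∧
      ∑ i, h i + P.B * ∑ j, p j ≤ 9 / 8 * (T * P.OPT) := by
  have hB := P.B_pos
  -- Prices are found for the budget 19/20·B. Returning to B costs a second factor 20/19, and
  -- (20/19)² < 9/8.
  obtain ⟨p, hp, hpm⟩ := exists_prices_of_convex (convex_convexHull ℝ P.totals)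
    (subset_convexHull ℝ _ zero_mem_totals) (b := 19 / 20 * P.B) (by positivity)
    (fun z hz hzB => reward_le_of_mem_convexHull hε hε0 hL hz hzB)
  set S : Fin T → Set ℝ := fun i => (fun a : Choice d => a.1 - ∑ j, p j * a.2 j) '' P.X i with hS
  have hle : ∀ i, ∀ y ∈ S i, y ≤ 1 := by
    rintro i _ ⟨a, ha, rfl⟩
    have h1 : 0 ≤ ∑ j, p j * a.2 j :=
      Finset.sum_nonneg fun j _ => mul_nonneg (hp j) (P.cost_mem i a ha j).1
    have h2 := (P.reward_mem i a ha).2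
    simp only
    linarith
  have hbdd : ∀ i, BddAbove (S i) := fun i => ⟨1, fun y hy => hle i y hy⟩
  have hzero : ∀ i, (0 : ℝ) ∈ S i := fun i => ⟨0, P.zero_mem i, by simp⟩
  refine ⟨p, fun i => sSup (S i), hp, fun i => ⟨le_csSup (hbdd i) (hzero i),
    csSup_le ⟨0, hzero i⟩ (hle i)⟩, fun i a ha => ?_, ?_⟩
  · have := le_csSup (hbdd i) ⟨a, ha, rfl⟩
    simp only at this
    linarith
  · have hsum : ∑ i, sSup (S i) + (∑ j, p j) * (19 / 20 * P.B) ≤ 20 / 19 * (T * P.OPT) := by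
      -- The suprema defining h need not be attained, so each request uses an option within δ of its
      -- supremum.
      refine le_of_forall_pos_add_mul_lt (k := -(T : ℝ) - 1) fun δ hδ => ?_
      have hnear : ∀ i, ∃ a ∈ P.X i, sSup (S i) - δ < a.1 - ∑ j, p j * a.2 j := by
        intro i
        obtain ⟨_, ⟨a, ha, rfl⟩, h⟩ := exists_lt_of_lt_csSup ⟨0, hzero i⟩
          (show sSup (S i) - δ < sSup (S i) by linarith)
        exact ⟨a, ha, h⟩
      choose c hcX hc using hnear
      have h1 := hpm _ (subset_convexHull ℝ _ ⟨c, hcX, rfl⟩)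
      have h2 : ∑ i, (sSup (S i) - δ) ≤ ∑ i, ((c i).1 - ∑ j, p j * (c i).2 j) :=
        Finset.sum_le_sum fun i _ => (hc i).le
      rw [Finset.sum_sub_distrib, Finset.sum_sub_distrib, Finset.sum_comm] at h2
      simp only [Finset.sum_const, Finset.card_univ, Fintype.card_fin, nsmul_eq_mul] at h2
      have h3 : ∑ j, p j * (∑ i, c i).2 j = ∑ j, ∑ i, p j * (c i).2 j := by
        refine Finset.sum_congr rfl fun j _ => ?_
        rw [Prod.snd_sum, Finset.sum_apply, Finset.mul_sum]
      rw [h3, Prod.fst_sum] at h1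
      linarith
    have h1 : 0 ≤ ∑ i, sSup (S i) := Finset.sum_nonneg fun i _ => le_csSup (hbdd i) (hzero i)
    have h2 : 0 ≤ T * P.OPT := mul_nonneg (Nat.cast_nonneg T) OPT_nonneg
    linarith

end Duality


/-! ### The packing LP -/

section LP

variable {d n : ℕ} {Y : Fin n → Set (Choice d)} {b : ℝ}

/-- Fractional solutions of the packing LP. -/
def IsFractional (Y : Fin n → Set (Choice d)) (b : ℝ) (x : Fin n → (Choice d →₀ ℝ)) : Prop :=
  (∀ i a, 0 ≤ x i a) ∧ (∀ i, ∀ a ∈ (x i).support, a ∈ Y i) ∧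
    (∀ i, ((x i).sum fun _ y => y) ≤ 1) ∧
    (∀ j, ∑ i, ((x i).sum fun a y => y * a.2 j) ≤ b)

lemma lpValue_eq : lpValue Y b =
    sSup {z | ∃ x, IsFractional Y b x ∧ z = ∑ i, (x i).sum fun a y => y * a.1} := by
  simp only [lpValue, IsFractional, and_assoc]

/-- Weak duality. -/
lemma IsFractional.reward_le {x : Fin n → (Choice d →₀ ℝ)} (hx : IsFractional Y b x)
    {h : Fin n → ℝ} {p : Fin d → ℝ} (hh : ∀ i, 0 ≤ h i) (hp : ∀ j, 0 ≤ p j)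
    (hY : ∀ i, ∀ a ∈ Y i, a.1 ≤ h i + ∑ j, p j * a.2 j) :
    ∑ i, ((x i).sum fun a y => y * a.1) ≤ ∑ i, h i + (∑ j, p j) * b := by
  obtain ⟨hx0, hxY, hx1, hxb⟩ := hx
  have h1 : ∀ i, ((x i).sum fun a y => y * a.1) ≤
      h i + ∑ j, p j * ((x i).sum fun a y => y * a.2 j) := by
    intro i
    have h2 : ((x i).sum fun a y => y * a.1) ≤
        (x i).sum fun a y => y * h i + ∑ j, p j * (y * a.2 j) := by
      refine Finset.sum_le_sum fun a ha => ?_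
      refine (mul_le_mul_of_nonneg_left (hY i a (hxY i a ha)) (hx0 i a)).trans (le_of_eq ?_)
      rw [mul_add, Finset.mul_sum]
      congr 1
      exact Finset.sum_congr rfl fun j _ => by ring
    refine h2.trans ?_
    simp only [Finsupp.sum] at hx1 ⊢
    rw [Finset.sum_add_distrib, ← Finset.sum_mul, Finset.sum_comm]
    simp only [Finset.mul_sum]
    exact add_le_add (mul_le_of_le_one_left (hh i) (hx1 i)) le_rfl
  refine (Finset.sum_le_sum fun i _ => h1 i).trans ?_
  rw [Finset.sum_add_distrib, Finset.sum_comm, Finset.sum_mul]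
  refine add_le_add le_rfl (Finset.sum_le_sum fun j _ => ?_)
  rw [← Finset.mul_sum]
  exact mul_le_mul_of_nonneg_left (hxb j) (hp j)

lemma lpValue_le {h : Fin n → ℝ} {p : Fin d → ℝ} (hb : 0 ≤ b) (hh : ∀ i, 0 ≤ h i)
    (hp : ∀ j, 0 ≤ p j) (hY : ∀ i, ∀ a ∈ Y i, a.1 ≤ h i + ∑ j, p j * a.2 j) :
    lpValue Y b ≤ ∑ i, h i + (∑ j, p j) * b := by
  rw [lpValue_eq]
  refine csSup_le ⟨0, fun _ => 0, ⟨by simp, by simp, by simp, by simpa using fun _ => hb⟩, by simp⟩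
    ?_
  rintro _ ⟨x, hx, rfl⟩
  exact hx.reward_le hh hp hY

lemma le_lpValue (hY : ∀ i, ∀ a ∈ Y i, a.1 ≤ 1) {c : Fin n → Choice d} (hc : ∀ i, c i ∈ Y i)
    (hcb : ∀ j, ∑ i, (c i).2 j ≤ b) : ∑ i, (c i).1 ≤ lpValue Y b := by
  classical
  rw [lpValue_eq]
  -- The trivial dual solution h = 1, p = 0 shows that the set of LP values is bounded above.
  refine le_csSup ⟨∑ _i : Fin n, (1 : ℝ) + (∑ _j : Fin d, (0 : ℝ)) * b, ?_⟩
    ⟨fun i => Finsupp.single (c i) 1, ⟨fun i a => ?_, fun i a ha => ?_, fun i => ?_, fun j => ?_⟩, ?_⟩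
  · rintro _ ⟨x, hx, rfl⟩
    exact hx.reward_le (fun _ => zero_le_one) (fun _ => le_rfl) (by simpa using hY)
  · rw [Finsupp.single_apply]
    split_ifs <;> norm_num
  · rw [Finset.mem_singleton.1 (Finsupp.support_single_subset ha)]
    exact hc i
  · simp
  · simpa using hcb j
  · simp

lemma lpValue_nonneg (hY : ∀ i, ∀ a ∈ Y i, 0 ≤ a.1) : 0 ≤ lpValue Y b := by
  rw [lpValue_eq]
  refine Real.sSup_nonneg ?_
  rintro _ ⟨x, hx, rfl⟩
  exact Finset.sum_nonneg fun i _ => Finset.sum_nonneg fun a ha =>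
    mul_nonneg (hx.1 i a) (hY i a (hx.2.1 i a ha))

lemma estimateZ_val (B : ℝ) (T : ℕ) (ε : ℝ) (Y : Fin n → Set (Choice d)) :
    (estimateZ B T ε Y).val =
      2 * (lpValue Y (n / T * B + eta d ε * Real.sqrt (n / T * B)) / (n / T)) / B := rfl

lemma estimateZ_nonneg {B : ℝ} (hB : 0 ≤ B) (T : ℕ) (ε : ℝ) (hY : ∀ i, ∀ a ∈ Y i, 0 ≤ a.1) :
    0 ≤ (estimateZ B T ε Y).val := by
  rw [estimateZ_val]
  have := lpValue_nonneg (b := n / T * B + eta d ε * Real.sqrt (n / T * B)) hY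
  positivity

end LP

/-! ### The sample -/

section Sample

variable {d T : ℕ} {P : Instance d T} {ε : ℝ}

lemma log_ratio_nonneg (hε : 0 < ε) (hε1 : ε ≤ 1) : 0 < Real.log ((d + 2) / ε ^ 2) := by
  refine Real.log_pos ?_
  rw [one_lt_div (by positivity)]
  have : (0 : ℝ) ≤ d := Nat.cast_nonneg d
  nlinarith

lemma eta_sq (hε : 0 < ε) (hε1 : ε ≤ 1) : eta d ε ^ 2 = 3 * Real.log ((d + 2) / ε ^ 2) :=
  Real.sq_sqrt (by linarith [log_ratio_nonneg (d := d) hε hε1])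

/-- The definition of η gives each of d + 2 tail events the probability ε²/(d + 2). -/
lemma exp_neg_eta_sq (hε : 0 < ε) (hε1 : ε ≤ 1) :
    Real.exp (-(eta d ε ^ 2 / 3)) = ε ^ 2 / (d + 2) := by
  rw [eta_sq hε hε1, mul_div_cancel_left₀ _ (by norm_num), Real.exp_neg,
    Real.exp_log (by positivity), inv_div]

lemma le_sampleSize : 4 * eta d ε ^ 2 * ε ^ 2 / Real.log (max d 2 : ℕ) * T ≤ sampleSize d T ε :=
  Nat.le_ceil _

/-- The constant is 4·18 from η² ≤ 18·log(1/ε)·L, plus 2 for rounding up, as 1 ≤ 2ε²T. -/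
lemma sampleSize_le (hε : 0 < ε) (hε0 : ε ≤ 1 / 100)
    (hL : Real.log (max d 2 : ℕ) / ε ^ 2 ≤ min P.B (T * P.OPT)) :
    (sampleSize d T ε : ℝ) ≤ 74 * (ε ^ 2 * Real.log (1 / ε)) * T := by
  have hLM := (le_min_iff.1 hL).2
  have hL1 := half_lt_log_max d
  have hlog := log_add_two_le d
  rw [div_le_iff₀ (by positivity)] at hLM
  have hMT := mul_OPT_le (P := P)
  have hη := eta_sq (d := d) hε (by linarith : ε ≤ 1)
  have hε1 : Real.log (1 / ε) = -Real.log ε := by rw [one_div, Real.log_inv]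
  have hℓ : 1 ≤ Real.log (1 / ε) := by
    rw [Real.le_log_iff_exp_le (by positivity)]
    have h1 := Real.exp_one_lt_d9
    have h2 : (100 : ℝ) ≤ 1 / ε := by
      rw [le_div_iff₀ hε]
      linarith
    linarith
  rw [Real.log_div (by positivity) (by positivity), Real.log_pow] at hη
  push_cast at hη
  set ℓ := Real.log (1 / ε) with hℓdef
  set L := Real.log (max d 2 : ℕ) with hLdef
  have hT0 : (0 : ℝ) ≤ T := Nat.cast_nonneg T
  have hη' : eta d ε ^ 2 ≤ 18 * ℓ * L := by
    have : ℓ * 1 ≤ ℓ * (2 * L) := mul_le_mul_of_nonneg_left hL1 (by linarith)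
    nlinarith
  have hq : 4 * eta d ε ^ 2 * ε ^ 2 / L ≤ 72 * (ε ^ 2 * ℓ) := by
    rw [div_le_iff₀ (by linarith)]
    have := mul_le_mul_of_nonneg_right hη' (sq_nonneg ε)
    linarith
  have h1 : (sampleSize d T ε : ℝ) < 4 * eta d ε ^ 2 * ε ^ 2 / L * T + 1 :=
    Nat.ceil_lt_add_one (mul_nonneg (div_nonneg (by positivity) (by linarith)) hT0)
  have h2 := mul_le_mul_of_nonneg_right hq hT0
  have h3 : 1 ≤ 2 * (ε ^ 2 * T) := by
    have := mul_le_mul_of_nonneg_right hMT (sq_nonneg ε)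
    linarith
  have h4 : ε ^ 2 * T * 1 ≤ ε ^ 2 * T * ℓ := mul_le_mul_of_nonneg_left hℓ (by positivity)
  linarith

lemma sq_mul_log_le (hε : 0 < ε) : ε ^ 2 * Real.log (1 / ε) ≤ ε := by
  have h1 := Real.log_le_sub_one_of_pos (show 0 < 1 / ε by positivity)
  have h2 : ε ^ 2 * (1 / ε) = ε := by field_simp
  nlinarith [mul_le_mul_of_nonneg_left h1 (sq_nonneg ε), sq_nonneg ε]

lemma sampleSize_le' (hε : 0 < ε) (hε0 : ε ≤ 1 / 100)
    (hL : Real.log (max d 2 : ℕ) / ε ^ 2 ≤ min P.B (T * P.OPT)) :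
    (sampleSize d T ε : ℝ) ≤ 74 * ε * T :=
  (sampleSize_le hε hε0 hL).trans (mul_le_mul_of_nonneg_right
    (by linarith [sq_mul_log_le hε]) (Nat.cast_nonneg T))

lemma card_pos_of_bound (hε : 0 < ε)
    (hL : Real.log (max d 2 : ℕ) / ε ^ 2 ≤ min P.B (T * P.OPT)) : 0 < T := by
  rcases Nat.eq_zero_or_pos T with rfl | h
  · have hLM := (le_min_iff.1 hL).2
    have hL1 := half_lt_log_max d
    rw [div_le_iff₀ (by positivity)] at hLM
    simp at hLM
    simp at hL1
    linarith
  · exact h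

lemma sampleSize_lt (hε : 0 < ε) (hε0 : ε ≤ 1 / 100)
    (hL : Real.log (max d 2 : ℕ) / ε ^ 2 ≤ min P.B (T * P.OPT)) : sampleSize d T ε < T := by
  have hT : (0 : ℝ) < T := by exact_mod_cast card_pos_of_bound hε hL
  have := sampleSize_le' hε hε0 hL
  have h : (sampleSize d T ε : ℝ) < T := by nlinarith
  exact_mod_cast h

lemma sampleSize_pos (hε : 0 < ε) (hε0 : ε ≤ 1 / 100)
    (hL : Real.log (max d 2 : ℕ) / ε ^ 2 ≤ min P.B (T * P.OPT)) : 0 < sampleSize d T ε := by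
  have hT : (0 : ℝ) < T := by exact_mod_cast card_pos_of_bound hε hL
  have hη : 0 < eta d ε ^ 2 := by
    rw [eta_sq hε (by linarith)]
    linarith [log_ratio_nonneg (d := d) hε (by linarith)]
  have hL0 : 0 < Real.log (max d 2 : ℕ) := by linarith [half_lt_log_max d]
  exact Nat.ceil_pos.2 (by positivity)

lemma estimatedZ_dependsOnPrefix : DependsOnPrefix (sampleSize d T ε) (estimatedZ P ε) := by
  intro π π' h
  simp only [estimatedZ]
  congr 2
  ext1 i
  exact arrival_congr h i.isLt

/-- The estimate is admissible unless one of `d + 2` tail events occurs. -/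
lemma permProb_estimatedZ (hε : 0 < ε) (hε0 : ε ≤ 1 / 100)
    (hL : Real.log (max d 2 : ℕ) / ε ^ 2 ≤ min P.B (T * P.OPT)) :
    1 - ε ^ 2 ≤ permProb (fun π : Equiv.Perm (Fin T) =>
      T * P.OPT / P.B ≤ estimatedZ P ε π ∧ estimatedZ P ε π ≤ 9 / 2 * (T * P.OPT / P.B)) := by
  have hB := P.B_pos
  have hε1 : ε ≤ 1 := by linarith
  have hT : (0 : ℝ) < T := by exact_mod_cast card_pos_of_bound hε hL
  have hnT := sampleSize_lt hε hε0 hL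
  have hn0 := sampleSize_pos hε hε0 hL
  have hnq := le_sampleSize (d := d) (T := T) (ε := ε)
  obtain ⟨p, h, hp, hh, hph, hD⟩ := exists_dual_solution hε hε0 hL
  have hexp := exp_neg_eta_sq (d := d) hε hε1
  have hη0 : 0 ≤ eta d ε := Real.sqrt_nonneg _
  obtain ⟨hLB, hLM⟩ := le_min_iff.1 hL
  have hL1 := half_lt_log_max d
  set n := sampleSize d T ε with hn
  set η := eta d ε with hη
  set L := Real.log (max d 2 : ℕ) with hLdef
  have hL0 : 0 < L := by linarith
  set M := T * P.OPT with hM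
  have hM0 : 0 < M := lt_of_lt_of_le (by positivity) hLM
  set δ : ℝ := n / T with hδ
  have hδ0 : 0 < δ := div_pos (by exact_mod_cast hn0) hT
  -- The sample size is made for this: in the sample, any total of at least L/ε² has mean at least
  -- 4η². It is applied to B and to M.
  have hδq : ∀ y, L / ε ^ 2 ≤ y → 4 * η ^ 2 ≤ δ * y := by
    intro y hy
    have h1 : 4 * η ^ 2 * ε ^ 2 / L ≤ δ := by
      rw [hδ, le_div_iff₀ hT]
      exact hnq
    calc 4 * η ^ 2 = 4 * η ^ 2 * ε ^ 2 / L * (L / ε ^ 2) := by field_simp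
      _ ≤ δ * y := mul_le_mul h1 hy (by positivity) hδ0.le
  have hδB := hδq P.B hLB
  have hδM := hδq M hLM
  obtain ⟨c, hc, hcR⟩ := exists_feasible_of_lt_OPT (P := P) (x := 19 / 20 * M) (by linarith)
  have hRM := sum_reward_le_OPT hc
  rw [← hM] at hRM
  set R := ∑ i, (c i).1 with hR
  set S : Finset (Fin T) := Finset.univ.map (Fin.castLEEmb hnT.le) with hS
  have hcard : (S.card : ℝ) = n := by simp [hS]
  have hmean : ∀ y : ℝ, (S.card : ℝ) * (y / T) = δ * y := fun y => by
    rw [hcard, hδ]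
    ring
  have hδB0 : 0 < δ * P.B := by positivity
  have hsq : Real.sqrt (δ * P.B) ^ 2 = δ * P.B := Real.sq_sqrt hδB0.le
  have hroot : 2 * η ≤ Real.sqrt (δ * P.B) := Real.le_sqrt_of_sq_le (by linarith)
  have hroot0 : 0 ≤ Real.sqrt (δ * P.B) := Real.sqrt_nonneg _
  have hslack : η * Real.sqrt (δ * P.B) ≤ δ * P.B := by
    have := mul_le_mul_of_nonneg_right hroot hroot0
    nlinarith
  -- the three kinds of tail events
  have hcost : ∀ j, permProb (fun π : Equiv.Perm (Fin T) => δ * ∑ i, (c i).2 j +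
      η * Real.sqrt (δ * P.B) < ∑ k ∈ S, (c (π k)).2 j) ≤ ε ^ 2 / (d + 2) := by
    intro j
    have h1 := permProb_upper_tail (x := fun i => (c i).2 j)
      (fun i => P.cost_mem i _ (hc.1 i) j) (a := η * Real.sqrt (δ * P.B)) (m := δ * P.B) S
      (by rw [hmean]; exact mul_le_mul_of_nonneg_left (hc.2 j) hδ0.le) hδB0 (by positivity)
      hslack
    rw [hmean] at h1
    refine h1.trans (le_of_eq ?_)
    rw [← hexp, mul_pow, hsq]
    congr 2
    field_simp
  -- The deviation is at least 9/20·δM, and (9/20·δM)²/(2δM) = 81/800·δM exceeds η²/3 because δM ≥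
  -- 4η².
  have hrew : permProb (fun π : Equiv.Perm (Fin T) => ∑ k ∈ S, (c (π k)).1 < δ * M / 2) ≤
      ε ^ 2 / (d + 2) := by
    have hRpos : 0 < R := by linarith
    have hδR := mul_lt_mul_of_pos_left hcR hδ0
    have hδRM := mul_le_mul_of_nonneg_left hRM hδ0.le
    have hδM0 : 0 < δ * M := mul_pos hδ0 hM0
    have h1 := permProb_lower_tail (x := fun i => (c i).1)
      (fun i => P.reward_mem i _ (hc.1 i)) (a := δ * R - δ * M / 2) (m := δ * R) S
      (hmean R) (by positivity) (by linarith)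
    rw [sub_sub_cancel] at h1
    refine h1.trans ?_
    rw [← hexp, Real.exp_le_exp, neg_le_neg_iff, le_div_iff₀ (by positivity)]
    have h2 : 9 / 20 * (δ * M) ≤ δ * R - δ * M / 2 := by linarith
    have h3 : (9 / 20 * (δ * M)) ^ 2 ≤ (δ * R - δ * M / 2) ^ 2 :=
      pow_le_pow_left₀ (by positivity) h2 2
    have h4 : η ^ 2 / 3 * (2 * (δ * R)) ≤ δ * M / 4 / 3 * (2 * (δ * M)) :=
      mul_le_mul (by linarith) (by linarith) (by positivity) (by positivity)
    have e1 : δ * M / 4 / 3 * (2 * (δ * M)) = 1 / 6 * (δ * M) ^ 2 := by ring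
    have e2 : (9 / 20 * (δ * M)) ^ 2 = 81 / 400 * (δ * M) ^ 2 := by ring
    linarith [sq_nonneg (δ * M)]
  -- The dual values h are fixed before sampling, so a single scalar tail event controls all
  -- solutions of the sample LP from above.
  have hdual : permProb (fun π : Equiv.Perm (Fin T) => δ * ∑ i, h i + δ * (9 / 8 * M) / 2 <
      ∑ k ∈ S, h (π k)) ≤ ε ^ 2 / (d + 2) := by
    have h0 : 0 ≤ P.B * ∑ j, p j := mul_nonneg hB.le (Finset.sum_nonneg fun j _ => hp j)
    have hδD : 0 < δ * (9 / 8 * M) := by positivity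
    have h1 := permProb_upper_tail hh (a := δ * (9 / 8 * M) / 2) (m := δ * (9 / 8 * M)) S
      (by rw [hmean]; exact mul_le_mul_of_nonneg_left (by linarith) hδ0.le) hδD (by positivity)
      (by linarith)
    rw [hmean] at h1
    refine h1.trans ?_
    have e : (δ * (9 / 8 * M) / 2) ^ 2 / (3 * (δ * (9 / 8 * M))) = 3 / 32 * (δ * M) := by
      field_simp
      ring
    rw [← hexp, Real.exp_le_exp, neg_le_neg_iff, e]
    linarith
  -- outside of these events the estimate is admissible
  have hgood : ∀ π : Equiv.Perm (Fin T),
      ¬ (M / P.B ≤ estimatedZ P ε π ∧ estimatedZ P ε π ≤ 9 / 2 * (M / P.B)) →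
      (∃ j, δ * ∑ i, (c i).2 j + η * Real.sqrt (δ * P.B) < ∑ k ∈ S, (c (π k)).2 j) ∨
      (∑ k ∈ S, (c (π k)).1 < δ * M / 2 ∨
        δ * ∑ i, h i + δ * (9 / 8 * M) / 2 < ∑ k ∈ S, h (π k)) := by
    intro π hπ
    by_contra! hno
    obtain ⟨h1, h2, h3⟩ := hno
    apply hπ
    have hY : ∀ i : Fin n, P.arrival π i = P.X (π (Fin.castLE hnT.le i)) :=
      fun i => arrival_of_lt π _
    simp only [hS, Finset.sum_map, Fin.castLEEmb_apply] at h1 h2 h3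
    -- Restricted to the sample, the comparison choice fits into the budget only thanks to the slack
    -- η√(δB).
    have hlow := le_lpValue (Y := fun i : Fin n => P.arrival π i)
      (b := δ * P.B + η * Real.sqrt (δ * P.B)) (c := fun i => c (π (Fin.castLE hnT.le i)))
      (fun i a ha => (P.reward_mem _ a (by rwa [hY] at ha)).2)
      (fun i => by rw [hY]; exact hc.1 _)
      (fun j => (h1 j).trans (by
        have := mul_le_mul_of_nonneg_left (hc.2 j) hδ0.le
        linarith))
    have hupp := lpValue_le (Y := fun i : Fin n => P.arrival π i)
      (b := δ * P.B + η * Real.sqrt (δ * P.B)) (h := fun i => h (π (Fin.castLE hnT.le i)))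
      (p := p) (by positivity) (fun i => (hh _).1) hp
      (fun i a ha => hph _ a (by rwa [hY] at ha))
    have hZ : estimatedZ P ε π = 2 * (lpValue (fun i : Fin n => P.arrival π i)
        (δ * P.B + η * Real.sqrt (δ * P.B)) / δ) / P.B := estimateZ_val _ _ _ _
    set V := lpValue (fun i : Fin n => P.arrival π i) (δ * P.B + η * Real.sqrt (δ * P.B))
    have hZ' : estimatedZ P ε π = 2 * V / δ / P.B := by
      rw [hZ]
      ring
    rw [hZ', ← mul_div_assoc, div_le_div_iff_of_pos_right hB, div_le_div_iff_of_pos_right hB,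
      le_div_iff₀ hδ0, div_le_iff₀ hδ0]
    refine ⟨by linarith, ?_⟩
    have h4 : η * Real.sqrt (δ * P.B) ≤ δ * P.B / 2 := by
      have := mul_le_mul_of_nonneg_right hroot hroot0
      linarith
    have h5 : 0 ≤ ∑ j, p j := Finset.sum_nonneg fun j _ => hp j
    -- In units of δM, the LP value is at most 3/2·9/8 from the dual solution with enlarged budget
    -- and 9/16 from the deviation of h, in total 9/4, half of 9/2.
    have h6 : (∑ j, p j) * (δ * P.B + η * Real.sqrt (δ * P.B)) ≤
        (∑ j, p j) * (3 / 2 * (δ * P.B)) := mul_le_mul_of_nonneg_left (by linarith) h5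
    have h7 : 0 ≤ δ * ∑ i, h i := mul_nonneg hδ0.le (Finset.sum_nonneg fun i _ => (hh i).1)
    have h8 := mul_le_mul_of_nonneg_left hD hδ0.le
    linarith
  have hbad := (permProb_mono hgood).trans ((permProb_or_le _ _).trans
    (add_le_add (permProb_exists_le _) (permProb_or_le _ _)))
  rw [permProb_compl] at hbad
  have hsum := Finset.sum_le_sum fun j (_ : j ∈ Finset.univ) => hcost j
  simp only [Finset.sum_const, Finset.card_univ, Fintype.card_fin, nsmul_eq_mul] at hsum
  have htot : (d : ℝ) * (ε ^ 2 / (d + 2)) + (ε ^ 2 / (d + 2) + ε ^ 2 / (d + 2)) = ε ^ 2 := by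
    field_simp
    ring
  linarith

end Sample


/-! ### The packing algorithm with a given parameter -/

section GivenParameter

variable {d T : ℕ} {P : Instance d T} {pick : Set (Choice d) → (Fin d → ℝ) → Choice d} {ε : ℝ}

lemma reward_nonneg_of_mem_arrival {π : Equiv.Perm (Fin T)} {t : ℕ} {a : Choice d}
    (ha : a ∈ P.arrival π t) : 0 ≤ a.1 := by
  unfold Instance.arrival at ha
  split_ifs at ha
  · exact (P.reward_mem _ a ha).1
  · rw [Set.mem_singleton_iff.1 ha]
    rfl

lemma pick_mem_arrival (hrule : IsArgmaxRule P pick) (π : Equiv.Perm (Fin T)) {t : ℕ} (ht : t < T)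
    (p : Fin d → ℝ) (hp : ∀ j, 0 ≤ p j) : pick (P.arrival π t) p ∈ P.arrival π t := by
  rw [arrival_of_lt π ht]
  exact (hrule _ p hp).1

lemma packingAlg_feasible (hrule : IsArgmaxRule P pick) (hε : 0 < ε) {Z : ℝ} (hZ : 0 ≤ Z) :
    (packingAlg pick P.B T ε Z).Feasible P := by
  refine fun π => ⟨fun t ht => packing_played_mem pick _ hε hZ t (zero_mem_arrival π t)
    (pick_mem_arrival hrule π ht), fun j => ?_⟩
  have h := packing_load pick (P.arrival π) (T := T) (ε := ε) (Z := Z) P.B_pos T j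
  rw [← h.1]
  exact h.2.le

lemma competitiveRatio_nonneg {σ : Type} {alg : Alg d σ} (h : alg.Feasible P) :
    0 ≤ alg.competitiveRatio P := by
  refine div_nonneg (permMean_nonneg fun π => Finset.sum_nonneg fun t ht => ?_)
    (mul_nonneg (Nat.cast_nonneg T) OPT_nonneg)
  exact reward_nonneg_of_mem_arrival ((h π).1 t (Finset.mem_range.1 ht))

lemma mul_OPT_pos (hε : 0 < ε)
    (hL : Real.log (max d 2 : ℕ) / ε ^ 2 ≤ min P.B (T * P.OPT)) : 0 < T * P.OPT := by
  have hL1 := half_lt_log_max d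
  exact lt_of_lt_of_le (div_pos (by linarith) (by positivity)) (le_min_iff.1 hL).2

lemma packingAlg_competitiveRatio (hrule : IsArgmaxRule P pick) (hε : 0 < ε) (hε1 : ε ≤ 1)
    (hL : Real.log (max d 2 : ℕ) / ε ^ 2 ≤ min P.B (T * P.OPT)) {K Z : ℝ}
    (hZ1 : T * P.OPT / P.B ≤ Z) (hZ2 : Z ≤ K * (T * P.OPT / P.B)) :
    1 - 36 * K * ε ≤ (packingAlg pick P.B T ε Z).competitiveRatio P := by
  have hM := mul_OPT_pos hε hL
  have hK : 1 ≤ K := by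
    have h0 : 0 < T * P.OPT / P.B := div_pos hM P.B_pos
    by_contra! h
    have := mul_lt_mul_of_pos_right h h0
    linarith
  have key := permMean_packing_ge hrule hε hε1 hL (Nat.zero_le T) (Z := fun _ => Z)
    (fun _ _ _ => rfl) (G := fun _ => True) (fun _ _ _ => rfl) hK (fun _ _ => hZ1) (fun _ _ => hZ2)
  have h1 : permProb (fun _ : Equiv.Perm (Fin T) => True) = 1 := by
    rw [permProb_eq_permMean]
    simp [permMean_const]
  simp only [h1, if_true, Nat.cast_zero, zero_mul, zero_add, one_mul, sub_zero, tsub_zero] at key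
  rw [Alg.competitiveRatio, le_div_iff₀ hM]
  linarith

end GivenParameter

/-! ### The complete algorithm -/

section Full

variable {d T : ℕ} {P : Instance d T} {pick : Set (Choice d) → (Fin d → ℝ) → Choice d} {ε : ℝ}
  {B : ℝ} (A : ℕ → Set (Choice d))

lemma estimateZ_get {n : ℕ} (l : List (Set (Choice d))) (hl : l = (List.range n).map A) :
    (estimateZ B T ε l.get).val = (estimateZ B T ε fun i : Fin n => A i).val := by
  have hlen : l.length = n := by simp [hl]
  subst hlen
  congr 2
  ext1 i
  have h : l[(i : ℕ)] = ((List.range l.length).map A)[(i : ℕ)]'(by simp) := by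
    congr 1
  simpa using h

/-- Even for sample size 0 one request is consumed before the estimate is made, hence the maximum
with 1 here and below. -/
lemma fullAlg_state_sampling {t : ℕ} (ht : t < max (sampleSize d T ε) 1) :
    (fullAlg pick B T ε).state A t = .sampling ((List.range t).map A) := by
  induction t with
  | zero => rfl
  | succ t ih =>
    have h : ((List.range t).map A ++ [A t]).length < sampleSize d T ε := by
      simp
      omega
    rw [Alg.state, ih (by omega)]
    simp only [fullAlg, fullStep]
    rw [if_pos h]
    simp [List.range_succ]

lemma fullAlg_played_sampling {t : ℕ} (ht : t < max (sampleSize d T ε) 1) :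
    (fullAlg pick B T ε).played A t = 0 := by
  rw [Alg.played, Alg.round, fullAlg_state_sampling A ht]
  simp only [fullAlg, fullStep]
  split_ifs <;> rfl

/-- The parameter used after the sample. -/
def fullParameter (B : ℝ) (T : ℕ) (ε : ℝ) (A : ℕ → Set (Choice d)) : ℝ :=
  (estimateZ B T ε fun i : Fin (max (sampleSize d T ε) 1) => A i).val

lemma fullAlg_state_running (t : ℕ) :
    (fullAlg pick B T ε).state A (max (sampleSize d T ε) 1 + t) =
      .running (fullParameter B T ε A) (packingState pick B T ε (fullParameter B T ε A)
        (fun k => A (max (sampleSize d T ε) 1 + k)) t) := by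
  induction t with
  | zero =>
    obtain ⟨m, hm⟩ : ∃ m, max (sampleSize d T ε) 1 = m + 1 :=
      ⟨max (sampleSize d T ε) 1 - 1, by omega⟩
    have h : ¬ ((List.range m).map A ++ [A m]).length < sampleSize d T ε := by
      simp
      omega
    have hZ : (estimateZ B T ε ((List.range m).map A ++ [A m]).get).val =
        fullParameter B T ε A :=
      estimateZ_get A _ (by simp [hm, List.range_succ])
    rw [add_zero, packingState_zero, hm, Alg.state, fullAlg_state_sampling A (by omega), ← hZ]
    simp only [fullAlg, fullStep]
    rw [if_neg h]
    rfl
  | succ t ih =>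
    rw [← add_assoc, Alg.state, ih, packingState_succ]
    rfl

lemma fullAlg_played_running (t : ℕ) :
    (fullAlg pick B T ε).played A (max (sampleSize d T ε) 1 + t) =
      (packingAlg pick B T ε (fullParameter B T ε A)).played
        (fun k => A (max (sampleSize d T ε) 1 + k)) t := by
  rw [Alg.played, Alg.round, fullAlg_state_running]
  rfl

/-- If the sample exhausts all requests both sides vanish, so feasibility needs no upper bound on ε.
-/
lemma fullAlg_sum_played {β : Type*} [AddCommMonoid β] (f : Choice d → β) (hf : f 0 = 0) :
    ∑ t ∈ Finset.range T, f ((fullAlg pick B T ε).played A t) =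
      ∑ t ∈ Finset.range (T - max (sampleSize d T ε) 1),
        f ((packingAlg pick B T ε (fullParameter B T ε A)).played
          (fun k => A (max (sampleSize d T ε) 1 + k)) t) := by
  rcases le_total (max (sampleSize d T ε) 1) T with h | h
  · have hsplit := Finset.sum_range_add (fun t => f ((fullAlg pick B T ε).played A t))
      (max (sampleSize d T ε) 1) (T - max (sampleSize d T ε) 1)
    rw [Nat.add_sub_cancel' h] at hsplit
    rw [hsplit, Finset.sum_eq_zero fun t ht => by
      rw [fullAlg_played_sampling A (Finset.mem_range.1 ht), hf], zero_add]
    simp only [fullAlg_played_running]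
  · rw [Nat.sub_eq_zero_of_le h, Finset.sum_range_zero]
    refine Finset.sum_eq_zero fun t ht => ?_
    rw [fullAlg_played_sampling A ((Finset.mem_range.1 ht).trans_le h), hf]

variable {A}

lemma fullParameter_nonneg (π : Equiv.Perm (Fin T)) :
    0 ≤ fullParameter P.B T ε (P.arrival π) :=
  estimateZ_nonneg P.B_pos.le T ε fun _ _ ha => reward_nonneg_of_mem_arrival ha

lemma fullAlg_feasible (hrule : IsArgmaxRule P pick) (hε : 0 < ε) :
    (fullAlg pick P.B T ε).Feasible P := by
  refine fun π => ⟨fun t ht => ?_, fun j => ?_⟩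
  · rcases Nat.lt_or_ge t (max (sampleSize d T ε) 1) with h | h
    · rw [fullAlg_played_sampling _ h]
      exact zero_mem_arrival π t
    · obtain ⟨k, rfl⟩ := Nat.exists_eq_add_of_le h
      rw [fullAlg_played_running]
      exact packing_played_mem pick (fun k => P.arrival π (max (sampleSize d T ε) 1 + k)) hε
        (fullParameter_nonneg π) k (zero_mem_arrival π _) (pick_mem_arrival hrule π ht)
  · rw [fullAlg_sum_played (P.arrival π) (fun a => a.2 j) rfl]
    have h := packing_load pick (fun k => P.arrival π (max (sampleSize d T ε) 1 + k)) (T := T)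
      (ε := ε) (Z := fullParameter P.B T ε (P.arrival π)) P.B_pos
      (T - max (sampleSize d T ε) 1) j
    rw [← h.1]
    exact h.2.le

lemma fullAlg_competitiveRatio (hrule : IsArgmaxRule P pick) (hε : 0 < ε) (hε0 : ε ≤ 1 / 100)
    (hL : Real.log (max d 2 : ℕ) / ε ^ 2 ≤ min P.B (T * P.OPT)) :
    1 - 240 * ε ≤ (fullAlg pick P.B T ε).competitiveRatio P := by
  have hM := mul_OPT_pos hε hL
  have hnT := sampleSize_lt hε hε0 hL
  have hn0 := sampleSize_pos hε hε0 hL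
  have hmax : max (sampleSize d T ε) 1 = sampleSize d T ε := max_eq_left hn0
  have hpar : ∀ π, fullParameter P.B T ε (P.arrival π) = estimatedZ P ε π := fun π => by
    rw [fullParameter, estimatedZ, hmax]
  have hprob := permProb_estimatedZ hε hε0 hL
  have hZ := estimatedZ_dependsOnPrefix (P := P) (ε := ε)
  have key := permMean_packing_ge hrule hε (by linarith) hL hnT.le hZ
    (G := fun π => T * P.OPT / P.B ≤ estimatedZ P ε π ∧
      estimatedZ P ε π ≤ 9 / 2 * (T * P.OPT / P.B))
    (fun π π' h => by simp only [hZ π π' h]) (K := 9 / 2) (by norm_num) (fun _ h => h.1)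
    (fun _ h => h.2)
  have hfeas := fullAlg_feasible (P := P) hrule hε
  rw [Alg.competitiveRatio, le_div_iff₀ hM]
  refine le_trans ?_ (key.trans (permMean_mono
    (g := fun π => ∑ t ∈ Finset.range T, ((fullAlg pick P.B T ε).played (P.arrival π) t).1)
    fun π => ?_))
  swap
  · split_ifs with hG
    · rw [fullAlg_sum_played (P.arrival π) Prod.fst rfl, hpar, hmax]
    · exact Finset.sum_nonneg fun t ht =>
        reward_nonneg_of_mem_arrival ((hfeas π).1 t (Finset.mem_range.1 ht))
  -- In units of ε·T·OPT: at most 1 for a failed estimate, 74 for the sample and 36·9/2 = 162 for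
  -- the run, in total 237.
  have h1 := mul_le_mul_of_nonneg_right hprob hM.le
  have h2 := mul_le_mul_of_nonneg_right (sampleSize_le' hε hε0 hL) (OPT_nonneg (P := P))
  have h3 : ε ^ 2 * (T * P.OPT) ≤ ε * (T * P.OPT) :=
    mul_le_mul_of_nonneg_right (by nlinarith) hM.le
  have h4 : 0 < ε * (T * P.OPT) := by positivity
  linarith

end Full

/-! ### Operation counts -/

section Counts

variable {d : ℕ} (pick : Set (Choice d) → (Fin d → ℝ) → Choice d) (B : ℝ) (T : ℕ) (ε : ℝ)

/-- Prices, loads, exit test, sum of weights and normalization take d operations each, the weights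
3d; the remaining 3 are scalars shared by all coordinates. -/
lemma packingStep_counts (Z : ℝ) (s : Memory d) (A : Set (Choice d)) :
    (packingStep pick B T ε Z s A).arith ≤ 8 * d + 3 ∧
    (packingStep pick B T ε Z s A).linMax ≤ 1 ∧ (packingStep pick B T ε Z s A).lp = 0 := by
  unfold packingStep
  split_ifs
  · simp
  · simp only [Counted.bind_arith, Counted.bind_linMax, Counted.bind_lp]
    split_ifs <;>
      simp [Counted.vec, Counted.op, Counted.maximize, Counted.anyGe, Counted.sum] <;> omega

lemma estimateZ_counts {n : ℕ} (Y : Fin n → Set (Choice d)) :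
    (estimateZ B T ε Y).arith = 14 ∧ (estimateZ B T ε Y).linMax = 0 ∧
      (estimateZ B T ε Y).lp = 1 := by
  simp [estimateZ, Counted.op, Counted.solveLP]

lemma fullStep_counts (s : FullMemory d) (A : Set (Choice d)) :
    (fullStep pick B T ε s A).arith ≤ 8 * d + 14 ∧ (fullStep pick B T ε s A).linMax ≤ 1 := by
  cases s with
  | sampling seen =>
    simp only [fullStep]
    split_ifs
    · simp
    · obtain ⟨h1, h2, -⟩ := estimateZ_counts B T ε (seen ++ [A]).get
      simp only [Counted.bind_arith, Counted.bind_linMax, Counted.pure_arith, Counted.pure_linMax,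
        h1, h2]
      omega
  | running Z s =>
    obtain ⟨h1, h2, -⟩ := packingStep_counts pick B T ε Z s A
    simp only [fullStep, Counted.bind_arith, Counted.bind_linMax, Counted.pure_arith,
      Counted.pure_linMax]
    omega

/-- The LP is solved in the step that leaves the sampling state, to which the algorithm never
returns. -/
lemma fullAlg_lp_le_one (A : ℕ → Set (Choice d)) (N : ℕ) :
    ∑ t ∈ Finset.range N, ((fullAlg pick B T ε).round A t).lp ≤ 1 := by
  have key : ∀ t, (∃ seen, (fullAlg pick B T ε).state A t = .sampling seen ∧
      ∑ k ∈ Finset.range t, ((fullAlg pick B T ε).round A k).lp = 0) ∨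
      ∃ Z s, (fullAlg pick B T ε).state A t = .running Z s ∧
      ∑ k ∈ Finset.range t, ((fullAlg pick B T ε).round A k).lp ≤ 1 := by
    intro t
    induction t with
    | zero => exact Or.inl ⟨[], rfl, by simp⟩
    | succ t ih =>
      rw [Finset.sum_range_succ, Alg.round, Alg.state]
      rcases ih with ⟨seen, hs, hsum⟩ | ⟨Z, s, hs, hsum⟩
      · rw [hs, hsum]
        simp only [fullAlg, fullStep]
        split_ifs
        · exact Or.inl ⟨_, rfl, by simp⟩
        · refine Or.inr ⟨_, _, rfl, ?_⟩
          simp [(estimateZ_counts B T ε _).2.2]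
      · rw [hs]
        refine Or.inr ⟨_, _, rfl, ?_⟩
        simp only [fullAlg, fullStep, Counted.bind_lp, Counted.pure_lp,
          (packingStep_counts pick B T ε Z s (A t)).2.2]
        simpa [fullAlg] using hsum
  rcases key N with ⟨_, -, h⟩ | ⟨_, _, -, h⟩ <;> omega

end Counts

end OnlinePacking

end

/-! ### Assembly of the four claims -/

open OnlinePacking in
theorem mainTheorem2 :
    -- competitive ratio `1 - O(ε)` for every admissible initialization of `Z`
    (∀ K : ℝ, ∃ C : ℝ, 0 < C ∧
      ∀ (d T : ℕ) (P : Instance d T) (pick : Set (Choice d) → (Fin d → ℝ) → Choice d)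
        (ε Z : ℝ), IsArgmaxRule P pick → 0 < ε →
        Real.log (max d 2 : ℕ) / ε ^ 2 ≤ min P.B (T * P.OPT) →
        T * P.OPT / P.B ≤ Z → Z ≤ K * (T * P.OPT / P.B) →
        (packingAlg pick P.B T ε Z).Feasible P ∧
        1 - C * ε ≤ (packingAlg pick P.B T ε Z).competitiveRatio P) ∧
    -- such a `Z` is found by solving one LP on a small sample
    (∃ C ε₀ : ℝ, 0 < C ∧ 0 < ε₀ ∧ ε₀ < 1 ∧
      ∀ (d T : ℕ) (P : Instance d T) (ε : ℝ), 0 < ε → ε ≤ ε₀ →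
        Real.log (max d 2 : ℕ) / ε ^ 2 ≤ min P.B (T * P.OPT) →
        sampleSize d T ε < T ∧
        (sampleSize d T ε : ℝ) ≤ C * (ε ^ 2 * Real.log (1 / ε)) * T ∧
        1 - ε ^ 2 ≤ permProb (fun π : Equiv.Perm (Fin T) =>
          T * P.OPT / P.B ≤ estimatedZ P ε π ∧
          estimatedZ P ε π ≤ 9 / 2 * (T * P.OPT / P.B))) ∧
    -- competitive ratio `1 - O(ε)` of the complete algorithm, which estimates `Z` itself
    (∃ C : ℝ, 0 < C ∧
      ∀ (d T : ℕ) (P : Instance d T) (pick : Set (Choice d) → (Fin d → ℝ) → Choice d)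
        (ε : ℝ), IsArgmaxRule P pick → 0 < ε →
        Real.log (max d 2 : ℕ) / ε ^ 2 ≤ min P.B (T * P.OPT) →
        (fullAlg pick P.B T ε).Feasible P ∧
        1 - C * ε ≤ (fullAlg pick P.B T ε).competitiveRatio P) ∧
    -- cost: fast steps, no LP if `Z` is given, and at most one LP in the complete algorithm
    (∃ c : ℕ, ∀ (d T : ℕ) (pick : Set (Choice d) → (Fin d → ℝ) → Choice d) (B ε : ℝ)
        (A : ℕ → Set (Choice d)),
        (∀ (Z : ℝ) (t : ℕ),
          ((packingAlg pick B T ε Z).round A t).arith ≤ c * (d + 1) ∧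
          ((packingAlg pick B T ε Z).round A t).linMax ≤ 1 ∧
          ((packingAlg pick B T ε Z).round A t).lp = 0) ∧
        (∀ t : ℕ,
          ((fullAlg pick B T ε).round A t).arith ≤ c * (d + 1) ∧
          ((fullAlg pick B T ε).round A t).linMax ≤ 1) ∧
        ∑ t ∈ Finset.range T, ((fullAlg pick B T ε).round A t).lp ≤ 1) := by
  refine ⟨fun K => ⟨36 * |K| + 1, by positivity, ?_⟩,
    ⟨74, 1 / 100, by norm_num, by norm_num, by norm_num, ?_⟩, ⟨240, by norm_num, ?_⟩, ⟨14, ?_⟩⟩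
  · intro d T P pick ε Z hrule hε hL hZ1 hZ2
    have hM := mul_OPT_pos hε hL
    have hfeas := packingAlg_feasible (P := P) hrule hε
      ((div_nonneg hM.le P.B_pos.le).trans hZ1)
    refine ⟨hfeas, ?_⟩
    have hK : 0 ≤ |K| := abs_nonneg K
    rcases le_or_gt ε 1 with h1 | h1
    · have h := packingAlg_competitiveRatio hrule hε h1 hL hZ1 hZ2
      have := mul_le_mul_of_nonneg_right (le_abs_self K) hε.le
      linarith
    -- For ε > 1 the claimed bound is negative, the summand 1 in the constant ensuring this for
    -- every K.
    · have := competitiveRatio_nonneg hfeas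
      nlinarith
  · intro d T P ε hε hε0 hL
    exact ⟨sampleSize_lt hε hε0 hL, sampleSize_le hε hε0 hL, permProb_estimatedZ hε hε0 hL⟩
  · intro d T P pick ε hrule hε hL
    have hfeas := fullAlg_feasible (P := P) hrule hε
    refine ⟨hfeas, ?_⟩
    rcases le_or_gt ε (1 / 100) with h1 | h1
    · exact fullAlg_competitiveRatio hrule hε h1 hL
    · have := competitiveRatio_nonneg hfeas
      linarith
  · intro d T pick B ε A
    refine ⟨fun Z t => ?_, fun t => ?_, fullAlg_lp_le_one pick B T ε A T⟩
    · obtain ⟨h1, h2, h3⟩ := packingStep_counts pick B T ε Z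
        ((packingAlg pick B T ε Z).state A t) (A t)
      exact ⟨h1.trans (by omega), h2, h3⟩
    · obtain ⟨h1, h2⟩ := fullStep_counts pick B T ε ((fullAlg pick B T ε).state A t) (A t)
      exact ⟨h1.trans (by omega), h2⟩
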